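/- **Theorem 1.2.** Let $(A,\mathfrak m)$ be a Gorenstein local ring (a Noetherian local ring of finite injective dimension over itself) of dimension $d\ge 1$. Let $\operatorname{CM}(A)$ be the category of maximal Cohen–Macaulay (MCM) $A$-modules (finitely generated modules that are zero or of depth $d$), and let $\underline{\operatorname{CM}}(A)$ be its stable category: it has the same objects, and its morphisms are the $A$-linear maps modulo those that factor through a finitely generated free module. Let $\underline{\operatorname{ICM}}(A)$ be the set of isomorphism classes $[M]$ of objects of $\underline{\operatorname{CM}}(A)$. For an MCM module $M$ let $G$ be a free module on a minimal generating set of $M^*=\operatorname{Hom}_A(M,A)$, let $i\colon M\to G^*$ be the map dual to $G\to M^*$, with cokernel $p\colon G^*\to\Omega^{-1}(M)$. The module $\Omega^{-1}(M)$ is again MCM, and $\Omega^{-1}$ is the translation functor of $\underline{\operatorname{CM}}(A)$. For $f\colon M\to N$ in $\operatorname{CM}(A)$ let $C(f)$ be the pushout of $f$ and $i$, which is again MCM, with maps $i'\colon N\to C(f)$ and $p'\colon C(f)\to\Omega^{-1}(M)$, where $p'i'=0$ and $p'$ restricts to $p$ on $G^*$. The exact triangles of $\underline{\operatorname{CM}}(A)$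 are the triangles isomorphic to the image of some $M\xrightarrow{f}N\xrightarrow{i'}C(f)\xrightarrow{-p'}\Omega^{-1}(M)$. Then the lengths $\ell\big(\operatorname{Tor}^A_1(M,A/\mathfrak m^{n+1})\big)$ are finite, and for every MCM module $M$ the limit $$e^T_A([M])=\lim_{n\to\infty}\frac{(d-1)!}{n^{d-1}}\,\ell\big(\operatorname{Tor}^A_1(M,A/\mathfrak m^{n+1})\big)$$ exists, is an integer and depends only on the class $[M]\in\underline{\operatorname{ICM}}(A)$. The function $e^T_A\colon\underline{\operatorname{ICM}}(A)\to\mathbb Z$ is a triangle function, that is: 1. $e^T_A([M])\ge 0$ for all $M$; 2. $e^T_A([M])=0$ if and only if $M=0$ in $\underline{\operatorname{CM}}(A)$, equivalently if and only if $M$ is a free $A$-module; 3. $e^T_A([M_1\oplus M_2])=e^T_A([M_1])+e^T_A([M_2])$ for all $M_1,M_2$; 4. for every exact triangle $M\to N\to L\to\Omega^{-1}(M)$ in $\underline{\operatorname{CM}}(A)$, - (a) $e^T_A([N])\le e^T_A([M])+e^T_A([L])$, - (b) $e^T_A([L])\le e^T_A([N])+e^T_A([\Omega^{-1}(M)])$,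 - (c) $e^T_A([\Omega^{-1}(M)])\le e^T_A([L])+e^T_A([\Omega^{-1}(N)])$. -/

import Mathlib

open CategoryTheory IsLocalRing

universe u

noncomputable section

/-- A Gorenstein local ring: a Noetherian local ring of finite injective dimension as a module
over itself. -/
structure IsGorensteinLocalRing (A : Type u) [CommRing A] [IsLocalRing A] : Prop where
  isNoetherianRing : IsNoetherianRing A
  finite_injectiveDimension : ∃ n : ℕ, HasInjectiveDimensionLT (ModuleCat.of A A) n

section LocalRing

variable (A : Type u) [CommRing A] [IsLocalRing A]

/-- Maximal Cohen-Macaulay modules: finitely generated modules `M` having a regular sequence in the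
maximal ideal of length `dim A`. A weakly regular sequence in the maximal ideal is automatically
regular on a nonzero finitely generated module (Nakayama), so for `M ≠ 0` this says
`depth M = dim A`; the zero module counts as maximal Cohen-Macaulay. -/
structure IsMCM (M : Type u) [AddCommGroup M] [Module A M] : Prop where
  finite : Module.Finite A M
  exists_regular : ∃ rs : List A, (∀ r ∈ rs, r ∈ maximalIdeal A) ∧
    RingTheory.Sequence.IsWeaklyRegular M rs ∧ (rs.length : WithBot ℕ∞) = ringKrullDim A

/-- `CM(A)`: the full subcategory of `A`-modules on the maximal Cohen-Macaulay ones. -/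
abbrev CM : Type (u + 1) :=
  ObjectProperty.FullSubcategory (fun M : ModuleCat.{u} A => IsMCM A M)

variable {A}

/-- The object of `CM(A)` given by a maximal Cohen-Macaulay module. -/
abbrev CM.of (M : Type u) [AddCommGroup M] [Module A M] (h : IsMCM A M) : CM A :=
  ⟨ModuleCat.of A M, h⟩

/-- The morphism of `CM(A)` given by an `A`-linear map. -/
abbrev CM.ofHom {M N : CM A} (f : M.obj →ₗ[A] N.obj) : M ⟶ N :=
  ObjectProperty.homMk (ModuleCat.ofHom f)

/-- The `A`-linear map underlying a morphism of `CM(A)`. -/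
abbrev CM.toLinearMap {M N : CM A} (f : M ⟶ N) : M.obj →ₗ[A] N.obj := f.hom.hom

/-- `f` factors through a finitely generated free module. -/
def FactorsThroughFree {M N : Type u} [AddCommGroup M] [Module A M] [AddCommGroup N] [Module A N]
    (f : M →ₗ[A] N) : Prop :=
  ∃ (n : ℕ) (a : M →ₗ[A] (Fin n → A)) (b : (Fin n → A) →ₗ[A] N), f = b ∘ₗ a

variable (A)

/-- Two morphisms of `CM(A)` are identified in the stable category when their difference factors
through a finitely generated free module. -/
def stableRel : HomRel (CM A) := fun _ _ f g =>
  FactorsThroughFree (CM.toLinearMap f - CM.toLinearMap g)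

/-- The relation is a congruence, so that passing to the quotient category identifies exactly the
related morphisms: `Hom(M, N)` in the quotient is `Hom_A(M, N) / P(M, N)`. -/
instance stableRel_congruence : Congruence (stableRel A) where
  equivalence := by
    intro X Y
    refine ⟨fun f => ⟨0, 0, 0, by simp⟩, ?_, ?_⟩
    · rintro f g ⟨n, a, b, h⟩
      exact ⟨n, a, -b, by rw [LinearMap.neg_comp, ← h, neg_sub]⟩
    · rintro f g k ⟨n, a, b, h⟩ ⟨m, c, e, h'⟩
      let s : (Fin (n + m) → A) ≃ₗ[A] (Fin n → A) × (Fin m → A) :=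
        (LinearEquiv.funCongrLeft A A finSumFinEquiv).trans
          (LinearEquiv.sumArrowLequivProdArrow (Fin n) (Fin m) A A)
      refine ⟨n + m, s.symm.toLinearMap ∘ₗ a.prod c, b.coprod e ∘ₗ s.toLinearMap, ?_⟩
      rw [← sub_add_sub_cancel _ (CM.toLinearMap g), h, h']
      ext x
      simp
  comp_left := by
    rintro X Y Z f g g' ⟨n, a, b, h⟩
    refine ⟨n, a ∘ₗ CM.toLinearMap f, b, ?_⟩
    rw [← LinearMap.comp_assoc, ← h]
    ext x
    simp
    rfl
  comp_right := by
    rintro X Y Z f f' g ⟨n, a, b, h⟩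
    refine ⟨n, a, CM.toLinearMap g ∘ₗ b, ?_⟩
    rw [LinearMap.comp_assoc, ← h]
    ext x
    simp
    rfl

/-- The stable category of maximal Cohen-Macaulay modules. -/
abbrev StableCM : Type (u + 1) := CategoryTheory.Quotient (stableRel A)

/-- The projection functor from `CM(A)` to the stable category. -/
abbrev stab : CM A ⥤ StableCM A := CategoryTheory.Quotient.functor (stableRel A)

/-- The set of isomorphism classes of the stable category. -/
abbrev ICM : Type (u + 1) := _root_.Quotient (isIsomorphicSetoid (StableCM A))

variable {A}

/-- The isomorphism class `[M]` in the stable category. -/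
def ICM.mk (X : StableCM A) : ICM A := _root_.Quotient.mk (isIsomorphicSetoid (StableCM A)) X

end LocalRing

section Cosyzygy

variable (A : Type u) [CommRing A] (M : Type u) [AddCommGroup M] [Module A M]

/-- The free module `G^*`, where `G` is free on a generating set of minimal cardinality of
`M^* = Hom_A(M, A)`. -/
abbrev Hull : Type u := (⊤ : Submodule A (Module.Dual A M)).generators → A

/-- The map `M → G^*` that is dual to the surjection `G → M^*`. -/
def hullι : M →ₗ[A] Hull A M := LinearMap.pi fun φ => φ.1

/-- The co-syzygy `Ω⁻¹(M)`: the cokernel of `M → G^*`. -/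
abbrev Cosyz : Type u := Hull A M ⧸ LinearMap.range (hullι A M)

/-- The projection `G^* → Ω⁻¹(M)`. -/
abbrev hullπ : Hull A M →ₗ[A] Cosyz A M := (LinearMap.range (hullι A M)).mkQ

variable {A M} {N : Type u} [AddCommGroup N] [Module A N] (f : M →ₗ[A] N)

/-- The pushout `C(f)` of `f : M → N` and `M → G^*`, as a quotient of `N × G^*`. -/
abbrev Cone : Type u := (N × Hull A M) ⧸ LinearMap.range (f.prod (-hullι A M))

/-- The map `i' : N → C(f)`. -/
def coneInl : N →ₗ[A] Cone f :=
  (LinearMap.range (f.prod (-hullι A M))).mkQ ∘ₗ LinearMap.inl A N (Hull A M)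

/-- The map `p' : C(f) → Ω⁻¹(M)`, zero on `N` and the projection on `G^*`. -/
def coneProj : Cone f →ₗ[A] Cosyz A M :=
  (LinearMap.range (f.prod (-hullι A M))).liftQ
    (hullπ A M ∘ₗ LinearMap.snd A N (Hull A M)) (by
      rintro _ ⟨x, rfl⟩
      simp)

end Cosyzygy

section Triangles

variable {A : Type u} [CommRing A] [IsLocalRing A]

variable (A) in
/-- Maximal Cohen-Macaulay modules are closed under direct sums, co-syzygies and the pushouts `C(f)`.
This makes these constructions operations on the objects of `CM(A)`. -/
structure MCMClosed : Prop where
  prod : ∀ M N : CM A, IsMCM A (M.obj × N.obj)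
  cosyz : ∀ M : CM A, IsMCM A (Cosyz A M.obj)
  cone : ∀ {M N : CM A} (f : M ⟶ N), IsMCM A (Cone (CM.toLinearMap f))

namespace MCMClosed

/-- The direct sum of two objects of `CM(A)`. -/
def sumObj (h : MCMClosed A) (M N : CM A) : CM A := CM.of (M.obj × N.obj) (h.prod M N)

/-- The co-syzygy `Ω⁻¹(M)` as an object of `CM(A)`. -/
def cosyzObj (h : MCMClosed A) (M : CM A) : CM A := CM.of (Cosyz A M.obj) (h.cosyz M)

/-- The pushout `C(f)` as an object of `CM(A)`. -/
def coneObj (h : MCMClosed A) {M N : CM A} (f : M ⟶ N) : CM A := CM.of (Cone (CM.toLinearMap f)) (h.cone f)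

/-- The map `i' : N ⟶ C(f)` in `CM(A)`. -/
def coneι (h : MCMClosed A) {M N : CM A} (f : M ⟶ N) : N ⟶ h.coneObj f :=
  CM.ofHom (N := h.coneObj f) (coneInl (CM.toLinearMap f))

/-- The map `-p' : C(f) ⟶ Ω⁻¹(M)` in `CM(A)`. -/
def coneδ (h : MCMClosed A) {M N : CM A} (f : M ⟶ N) : h.coneObj f ⟶ h.cosyzObj M :=
  CM.ofHom (M := h.coneObj f) (N := h.cosyzObj M) (-coneProj (CM.toLinearMap f))

/-- The translation `Ω⁻¹` on objects of the stable category. -/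
def shiftObj (h : MCMClosed A) (X : StableCM A) : StableCM A := (stab A).obj (h.cosyzObj X.as)

/-- The translation `Ω⁻¹` on morphisms of the stable category, as a relation:
`δ = Ω⁻¹(α)` when representatives `a`, `c` of `α`, `δ` fit into a commutative diagram with
exact rows `M → G^* → Ω⁻¹(M) → 0` and `M' → G'^* → Ω⁻¹(M') → 0`. -/
def IsShiftMap (h : MCMClosed A) {X Y : StableCM A} (α : X ⟶ Y) (δ : h.shiftObj X ⟶ h.shiftObj Y) : Prop :=
  ∃ (a : X.as.obj →ₗ[A] Y.as.obj) (q : Hull A X.as.obj →ₗ[A] Hull A Y.as.obj)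
    (c : Cosyz A X.as.obj →ₗ[A] Cosyz A Y.as.obj),
    q ∘ₗ hullι A X.as.obj = hullι A Y.as.obj ∘ₗ a ∧
    c ∘ₗ hullπ A X.as.obj = hullπ A Y.as.obj ∘ₗ q ∧
    α = (stab A).map (CM.ofHom a) ∧
    δ = (stab A).map (CM.ofHom (M := h.cosyzObj X.as) (N := h.cosyzObj Y.as) c)

/-- Exact triangles `M → N → L → Ω⁻¹(M)` of the stable category: those isomorphic to the image of
`M' → N' → C(f) → Ω⁻¹(M')` for some morphism `f : M' ⟶ N'` of `CM(A)`. -/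
def IsExactTriangle (h : MCMClosed A) {M N L : StableCM A} (u : M ⟶ N) (v : N ⟶ L) (w : L ⟶ h.shiftObj M) : Prop :=
  ∃ (M' N' : CM A) (f : M' ⟶ N')
    (α : M ≅ (stab A).obj M') (β : N ≅ (stab A).obj N') (γ : L ≅ (stab A).obj (h.coneObj f))
    (δ : h.shiftObj M ≅ h.shiftObj ((stab A).obj M')),
    h.IsShiftMap α.hom δ.hom ∧
    u ≫ β.hom = α.hom ≫ (stab A).map f ∧
    v ≫ γ.hom = β.hom ≫ (stab A).map (h.coneι f) ∧
    w ≫ δ.hom = γ.hom ≫ (stab A).map (h.coneδ f)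

/-- Triangle functions on the set of isomorphism classes of the stable category. -/
structure IsTriangleFunction (h : MCMClosed A) (ξ : ICM A → ℤ) : Prop where
  nonneg : ∀ M : StableCM A, 0 ≤ ξ (ICM.mk M)
  eq_zero_iff : ∀ M : StableCM A, ξ (ICM.mk M) = 0 ↔ Limits.IsZero M
  map_sum : ∀ M N : CM A, ξ (ICM.mk ((stab A).obj (h.sumObj M N))) =
    ξ (ICM.mk ((stab A).obj M)) + ξ (ICM.mk ((stab A).obj N))
  subadditive : ∀ {M N L : StableCM A} (u : M ⟶ N) (v : N ⟶ L) (w : L ⟶ h.shiftObj M),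
    h.IsExactTriangle u v w →
      ξ (ICM.mk N) ≤ ξ (ICM.mk M) + ξ (ICM.mk L) ∧
      ξ (ICM.mk L) ≤ ξ (ICM.mk N) + ξ (ICM.mk (h.shiftObj M)) ∧
      ξ (ICM.mk (h.shiftObj M)) ≤ ξ (ICM.mk L) + ξ (ICM.mk (h.shiftObj N))

end MCMClosed

end Triangles

/-- The length of `Tor_1^A(M, A/𝔪^(n+1))`, possibly infinite. -/
def torLength (A : Type u) [CommRing A] [IsLocalRing A] (M : ModuleCat.{u} A) (n : ℕ) : ℕ∞ :=
  Module.length A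
    (((Tor (ModuleCat.{u} A) 1).obj M).obj (ModuleCat.of A (A ⧸ maximalIdeal A ^ (n + 1))))

end

/-! Choose a presentation `0 → L → F → M → 0` with `F` finite free. Then `Tor₁(M, A/𝔪ⁿ) = (L ∩
𝔪ⁿF)/𝔪ⁿL` (`torLength_eq_relLength`). Its length is a difference of the length functions of two
stable filtrations of `L`, so by Hilbert-Serre it is eventually polynomial. Artin-Rees gives `L ∩
𝔪ⁿ⁺ᶜF ⊆ 𝔪ⁿL`, which bounds the length at `n + c` by `H(n + c) - H(n)`, where `H` is the
Hilbert-Samuel function of `L`. Since `H` has degree at most `d`, the Tor length has degree at most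
`d - 1` (`EventuallyPoly.relLength_inf`). Integer-valued polynomials have integer coefficients in
the binomial basis, so the normalized limit is an integer (`EventuallyPoly.exists_tendsto`).

If the presentation is minimal, `L ⊆ 𝔪F` gives `𝔪ⁿL ⊆ L ∩ 𝔪ⁿ⁺¹F`, so the first difference of `H` is
bounded by the Tor length. A zero limit then forces `H` to have degree below `d`. But `L` is MCM,
and a nonzero module with a regular sequence of length `d` has `H` of degree at least `d`. Hence `L
= 0` and `M` is free (`free_of_eventuallyPoly_torLength`).

Maps through free modules act as zero on `Tor₁`, so the length is a stable invariant. The three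
triangle inequalities are half-exactness of `Tor₁` on `0 → M → N × G^* → C(f) → 0`, on `0 → N → C(f)
→ Ω⁻¹(M) → 0`, and on `0 → C(f) → Ω⁻¹(M) × H → Ω⁻¹(N) → 0` with `H` the hull of `N`. The last
sequence needs `N → H` to extend over `C(f)`, that is, `Ext¹(Ω⁻¹(M), A) = 0`.

The Gorenstein input is that depth, dimension and injective dimension of `A` agree
(`IsGorensteinLocalRing.isMCM_and_extVanishes`, proved by means of a nonzero MCM module), so that
`Extⁱ(M, A) = 0` for `i ≥ 1` and `M` MCM. Modulo a maximal regular sequence, `A` becomes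
self-injective on finitely generated modules. Hence functionals separate points there, and `M → G^*`
is injective with MCM cokernel (`IsMCM.hullι_injective_and_cosyz`). -/

/-! ### Eventually polynomial functions and their leading coefficients -/

/-- `f : ℕ → ℤ` eventually agrees with an integer-valued polynomial of degree less than `r`:
the `r`-th forward difference of `f` is eventually zero. -/
def EventuallyPoly : ℕ → (ℕ → ℤ) → Prop
  | 0, f => ∀ᶠ n in Filter.atTop, f n = 0
  | r + 1, f => EventuallyPoly r (fun n => f (n + 1) - f n)

namespace EventuallyPoly

open Filter Finset

lemma congr {r : ℕ} {f g : ℕ → ℤ} (h : ∀ᶠ n in atTop, f n = g n) (hf : EventuallyPoly r f) :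
    EventuallyPoly r g := by
  induction r generalizing f g with
  | zero =>
    filter_upwards [h, (hf : ∀ᶠ n in atTop, f n = 0)] with n h1 h2
    rw [← h1, h2]
  | succ r ih =>
    refine ih ?_ (hf : EventuallyPoly r _)
    filter_upwards [h, (tendsto_add_atTop_nat 1).eventually h] with n h1 h2
    rw [h1, h2]

lemma zero (r : ℕ) : EventuallyPoly r (fun _ => 0) := by
  induction r with
  | zero => exact Eventually.of_forall fun _ => rfl
  | succ r ih => simpa [EventuallyPoly] using ih

lemma add {r : ℕ} {f g : ℕ → ℤ} (hf : EventuallyPoly r f) (hg : EventuallyPoly r g) :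
    EventuallyPoly r (fun n => f n + g n) := by
  induction r generalizing f g with
  | zero =>
    filter_upwards [(hf : ∀ᶠ n in atTop, f n = 0), (hg : ∀ᶠ n in atTop, g n = 0)] with n h1 h2
    rw [h1, h2, add_zero]
  | succ r ih =>
    refine congr (r := r) (Eventually.of_forall fun n => ?_) (ih (f := fun n => f (n + 1) - f n)
      (g := fun n => g (n + 1) - g n) hf hg)
    ring

lemma const_mul {r : ℕ} {f : ℕ → ℤ} (c : ℤ) (hf : EventuallyPoly r f) :
    EventuallyPoly r (fun n => c * f n) := by
  induction r generalizing f with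
  | zero =>
    filter_upwards [(hf : ∀ᶠ n in atTop, f n = 0)] with n h1
    rw [h1, mul_zero]
  | succ r ih =>
    refine congr (r := r) (Eventually.of_forall fun n => ?_) (ih (f := fun n => f (n + 1) - f n) hf)
    ring

lemma sub {r : ℕ} {f g : ℕ → ℤ} (hf : EventuallyPoly r f) (hg : EventuallyPoly r g) :
    EventuallyPoly r (fun n => f n - g n) :=
  congr (Eventually.of_forall fun n => by ring) (hf.add (hg.const_mul (-1)))

lemma succ {r : ℕ} {f : ℕ → ℤ} (hf : EventuallyPoly r f) : EventuallyPoly (r + 1) f := by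
  induction r generalizing f with
  | zero =>
    have hf' : ∀ᶠ n in atTop, f n = 0 := hf
    change ∀ᶠ n in atTop, f (n + 1) - f n = 0
    filter_upwards [hf', (tendsto_add_atTop_nat 1).eventually hf'] with n h1 h2
    rw [h1, h2, sub_zero]
  | succ r ih => exact ih (f := fun n => f (n + 1) - f n) hf

lemma mono {r s : ℕ} (h : r ≤ s) {f : ℕ → ℤ} (hf : EventuallyPoly r f) : EventuallyPoly s f := by
  induction s, h using Nat.le_induction with
  | base => exact hf
  | succ s _ ih => exact ih.succ

lemma shift {r : ℕ} {f : ℕ → ℤ} (hf : EventuallyPoly r f) (c : ℕ) :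
    EventuallyPoly r (fun n => f (n + c)) := by
  induction r generalizing f with
  | zero => exact (tendsto_add_atTop_nat c).eventually (hf : ∀ᶠ n in atTop, f n = 0)
  | succ r ih =>
    refine congr (r := r) (Eventually.of_forall fun n => ?_) (ih (f := fun n => f (n + 1) - f n) hf)
    simp only [add_right_comm]

lemma of_shift {r : ℕ} {f : ℕ → ℤ} (c : ℕ) (hf : EventuallyPoly r (fun n => f (n + c))) :
    EventuallyPoly r f := by
  induction r generalizing f with
  | zero =>
    obtain ⟨N, hN⟩ := eventually_atTop.1 (hf : ∀ᶠ n in atTop, f (n + c) = 0)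
    refine eventually_atTop.2 ⟨N + c, fun n hn => ?_⟩
    have := hN (n - c) (by omega)
    simpa only [Nat.sub_add_cancel (show c ≤ n by omega)] using this
  | succ r ih =>
    refine ih (f := fun n => f (n + 1) - f n)
      (congr (Eventually.of_forall fun n => ?_) (hf : EventuallyPoly r _))
    simp only [add_right_comm]

lemma shift_sub {r : ℕ} {f : ℕ → ℤ} (hf : EventuallyPoly (r + 1) f) (c : ℕ) :
    EventuallyPoly r (fun n => f (n + c) - f n) := by
  induction c with
  | zero => exact congr (Eventually.of_forall fun n => by simp) (zero r)
  | succ c ih =>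
    refine congr (Eventually.of_forall fun n => ?_)
      ((shift (f := fun n => f (n + 1) - f n) hf c).add ih)
    simp only [← add_assoc]
    ring

lemma const (c : ℤ) : EventuallyPoly 1 (fun _ => c) :=
  Eventually.of_forall fun _ => sub_self c

lemma choose (i : ℕ) : EventuallyPoly (i + 1) (fun n => (n.choose i : ℤ)) := by
  induction i with
  | zero => simpa using const 1
  | succ i ih =>
    change EventuallyPoly (i + 1) (fun n => ((n + 1).choose (i + 1) : ℤ) - (n.choose (i + 1) : ℤ))
    refine congr (Eventually.of_forall fun n => ?_) ih
    rw [Nat.choose_succ_succ]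
    push_cast
    ring

lemma sum_choose (r : ℕ) (c : ℕ → ℤ) :
    EventuallyPoly r (fun n => ∑ i ∈ range r, c i * (n.choose i : ℤ)) := by
  induction r with
  | zero => simpa using zero 0
  | succ r ih =>
    simp only [sum_range_succ]
    exact ih.succ.add ((choose r).const_mul (c r))

/-- Newton's expansion: summing the expansion of the first difference raises every binomial index by
one and leaves only a constant to be determined. -/
lemma exists_eq_sum_choose {r : ℕ} {f : ℕ → ℤ} (hf : EventuallyPoly r f) :
    ∃ c : ℕ → ℤ, ∀ᶠ n in atTop, f n = ∑ i ∈ range r, c i * (n.choose i : ℤ) := by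
  induction r generalizing f with
  | zero => exact ⟨0, by simpa [EventuallyPoly] using hf⟩
  | succ r ih =>
    obtain ⟨c, hc⟩ := ih (f := fun n => f (n + 1) - f n) hf
    obtain ⟨N, hN⟩ := eventually_atTop.1 hc
    let g : ℕ → ℤ := fun n => ∑ i ∈ range r, c i * (n.choose (i + 1) : ℤ)
    have hg : ∀ n, g (n + 1) - g n = ∑ i ∈ range r, c i * (n.choose i : ℤ) := by
      intro n
      rw [← sum_sub_distrib]
      refine sum_congr rfl fun i _ => ?_
      rw [Nat.choose_succ_succ]
      push_cast
      ring
    -- The constant term matches `f` with the discrete antiderivative `g` at the threshold `N`.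
    refine ⟨fun i => Nat.casesOn i (f N - g N) c, eventually_atTop.2 ⟨N, fun n hn => ?_⟩⟩
    rw [sum_range_succ']
    simp only [Nat.choose_zero_right, Nat.cast_one, mul_one]
    change f n = g n + (f N - g N)
    induction n, hn using Nat.le_induction with
    | base => ring
    | succ n hn ih' =>
      have h1 := hN n hn
      rw [← hg] at h1
      linarith

lemma tendsto_choose (i k : ℕ) (h : i ≤ k) :
    Tendsto (fun n : ℕ => ((k.factorial : ℝ) / (n : ℝ) ^ k) * (n.choose i : ℝ)) atTop
      (nhds (if i = k then 1 else 0)) := by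
  have h1 : Tendsto (fun n : ℕ => (n.choose i : ℝ) / ((n : ℝ) ^ i / i.factorial)) atTop (nhds 1) :=
    (Asymptotics.isEquivalent_iff_tendsto_one (by
      filter_upwards [eventually_gt_atTop 0] with n hn
      positivity)).1 (isEquivalent_choose i)
  split_ifs with hik
  · subst hik
    refine h1.congr' ?_
    filter_upwards [eventually_gt_atTop 0] with n hn
    field_simp
  · obtain ⟨j, rfl⟩ : ∃ j, k = i + (j + 1) := ⟨k - i - 1, by omega⟩
    have h2 : Tendsto (fun n : ℕ => (((i + (j + 1)).factorial : ℝ) / i.factorial) *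
        ((n : ℝ) ^ (j + 1))⁻¹) atTop (nhds 0) := by
      have := (tendsto_pow_atTop (n := j + 1) (by omega)).comp
        (tendsto_natCast_atTop_atTop (R := ℝ))
      simpa using this.inv_tendsto_atTop.const_mul (((i + (j + 1)).factorial : ℝ) / i.factorial)
    have h3 := h2.mul h1
    rw [zero_mul] at h3
    refine h3.congr' ?_
    filter_upwards [eventually_gt_atTop 0] with n hn
    field_simp
    ring

lemma exists_tendsto {r : ℕ} {f : ℕ → ℤ} (hf : EventuallyPoly (r + 1) f) :
    ∃ c : ℤ, Tendsto (fun n : ℕ => ((r.factorial : ℝ) / (n : ℝ) ^ r) * (f n : ℝ)) atTop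
      (nhds (c : ℝ)) ∧ (c = 0 → EventuallyPoly r f) := by
  obtain ⟨c, hc⟩ := hf.exists_eq_sum_choose
  refine ⟨c r, ?_, fun h0 => ?_⟩
  · have h1 : Tendsto (fun n : ℕ => ∑ i ∈ range (r + 1),
        (c i : ℝ) * (((r.factorial : ℝ) / (n : ℝ) ^ r) * (n.choose i : ℝ))) atTop
        (nhds (∑ i ∈ range (r + 1), (c i : ℝ) * (if i = r then 1 else 0))) :=
      tendsto_finsetSum _ fun i hi =>
        (tendsto_choose i r (Nat.lt_succ_iff.1 (mem_range.1 hi))).const_mul _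
    simp only [mul_ite, mul_one, mul_zero, sum_ite_eq', mem_range, Nat.lt_succ_self,
      if_true] at h1
    refine h1.congr' ?_
    filter_upwards [hc] with n hn
    rw [hn]
    push_cast
    rw [mul_sum]
    exact sum_congr rfl fun i _ => by ring
  · refine congr ?_ (sum_choose r c)
    filter_upwards [hc] with n hn
    rw [hn, sum_range_succ, h0]
    ring

lemma tendsto_zero {r : ℕ} {f : ℕ → ℤ} (hf : EventuallyPoly r f) :
    Tendsto (fun n : ℕ => ((r.factorial : ℝ) / (n : ℝ) ^ r) * (f n : ℝ)) atTop (nhds 0) := by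
  obtain ⟨c, hc⟩ := hf.exists_eq_sum_choose
  have h1 : Tendsto (fun n : ℕ => ∑ i ∈ range r,
      (c i : ℝ) * (((r.factorial : ℝ) / (n : ℝ) ^ r) * (n.choose i : ℝ))) atTop
      (nhds (∑ i ∈ range r, (c i : ℝ) * (if i = r then 1 else 0))) :=
    tendsto_finsetSum _ fun i hi => (tendsto_choose i r (mem_range.1 hi).le).const_mul _
  simp only [mul_ite, mul_one, mul_zero, sum_ite_eq', mem_range, lt_irrefl, if_false] at h1
  refine h1.congr' ?_
  filter_upwards [hc] with n hn
  rw [hn]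
  push_cast
  rw [mul_sum]
  exact sum_congr rfl fun i _ => by ring

/-- Squeezing makes the limit normalized by the top power zero, so the top binomial coefficient
vanishes; this is repeated until the degree bound of `g` is reached. -/
lemma of_le {r k : ℕ} {f g : ℕ → ℤ} (hf : EventuallyPoly r f) (hg : EventuallyPoly k g)
    (h0 : ∀ᶠ n in atTop, 0 ≤ f n) (h : ∀ᶠ n in atTop, f n ≤ g n) : EventuallyPoly k f := by
  rcases le_total r k with hrk | hrk
  · exact hf.mono hrk
  induction r, hrk using Nat.le_induction with
  | base => exact hf
  | succ r hkr ih =>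
    refine ih ?_
    obtain ⟨c, hc, hc0⟩ := hf.exists_tendsto
    refine hc0 ?_
    have hlim := (hg.mono hkr).tendsto_zero
    have : Tendsto (fun n : ℕ => ((r.factorial : ℝ) / (n : ℝ) ^ r) * (f n : ℝ)) atTop (nhds 0) := by
      refine squeeze_zero' ?_ ?_ hlim
      · filter_upwards [h0] with n hn
        have : (0 : ℝ) ≤ f n := by exact_mod_cast hn
        positivity
      · filter_upwards [h] with n hn
        have : (f n : ℝ) ≤ g n := by exact_mod_cast hn
        gcongr
    exact_mod_cast tendsto_nhds_unique hc this

end EventuallyPoly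

/-! ### Lengths of subquotients of a fixed module -/

section RelLength

variable {A E E' : Type*} [CommRing A] [AddCommGroup E] [Module A E] [AddCommGroup E'] [Module A E']

/-- The length of `Q / (P ∩ Q)`. -/
noncomputable def relLength (P Q : Submodule A E) : ℕ∞ := Module.length A (Q ⧸ P.comap Q.subtype)

lemma relLength_eq_of_surjective {Z : Type*} [AddCommGroup Z] [Module A Z] {P Q : Submodule A E}
    (g : Q →ₗ[A] Z) (hg : Function.Surjective g) (hker : ∀ q : Q, g q = 0 ↔ (q : E) ∈ P) :
    relLength P Q = Module.length A Z := by
  have h : P.comap Q.subtype = LinearMap.ker g := by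
    ext q
    rw [LinearMap.mem_ker, hker, Submodule.mem_comap, Submodule.subtype_apply]
  rw [relLength, h]
  exact (g.quotKerEquivOfSurjective hg).length_eq

lemma relLength_eq_zero_iff {P Q : Submodule A E} : relLength P Q = 0 ↔ Q ≤ P := by
  rw [relLength, Module.length_eq_zero_iff, Submodule.Quotient.subsingleton_iff,
    Submodule.comap_subtype_eq_top]

lemma relLength_add {P R Q : Submodule A E} (hPR : P ≤ R) (hRQ : R ≤ Q) :
    relLength P Q = relLength P R + relLength R Q := by
  have h1 : P.comap R.subtype ≤ (P.comap Q.subtype).comap (Submodule.inclusion hRQ) :=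
    fun x hx => hx
  have h2 : P.comap Q.subtype ≤ R.comap Q.subtype := Submodule.comap_mono hPR
  refine Module.length_eq_add_of_exact ((P.comap R.subtype).mapQ (P.comap Q.subtype) _ h1)
    (Submodule.factor h2) ?_ (Submodule.factor_surjective _) ?_
  · rw [← LinearMap.ker_eq_bot, LinearMap.ker_eq_bot']
    intro x
    obtain ⟨x, rfl⟩ := Submodule.Quotient.mk_surjective _ x
    intro hx
    rw [Submodule.mapQ_apply, Submodule.Quotient.mk_eq_zero] at hx
    rw [Submodule.Quotient.mk_eq_zero]
    exact hx
  · intro x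
    obtain ⟨x, rfl⟩ := Submodule.Quotient.mk_surjective _ x
    constructor
    · intro hx
      have hx' : x ∈ R.comap Q.subtype := (Submodule.Quotient.mk_eq_zero _).1 hx
      exact ⟨Submodule.Quotient.mk ⟨x, hx'⟩, rfl⟩
    · rintro ⟨y, hy⟩
      obtain ⟨y, rfl⟩ := Submodule.Quotient.mk_surjective _ y
      rw [← hy]
      exact (Submodule.Quotient.mk_eq_zero _).2 y.2

/-- First isomorphism theorem for the composite `Q → E' → E'/P`. -/
lemma relLength_comap_inf (f : E →ₗ[A] E') (P : Submodule A E') (Q : Submodule A E) :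
    relLength (Q ⊓ P.comap f) Q = relLength P (Q.map f ⊔ P) := by
  rw [relLength_eq_of_surjective (Z := (Q.map f ⊔ P : Submodule A E') ⧸ P.comap (Q.map f ⊔ P).subtype)
    ((P.comap (Q.map f ⊔ P).subtype).mkQ ∘ₗ (f ∘ₗ Q.subtype).codRestrict _
      (fun q => Submodule.mem_sup_left ⟨q, q.2, rfl⟩))]
  · rfl
  · intro z
    obtain ⟨⟨z, hz⟩, rfl⟩ := Submodule.mkQ_surjective _ z
    obtain ⟨y, ⟨q, hq, rfl⟩, p, hp, rfl⟩ := Submodule.mem_sup.1 hz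
    refine ⟨⟨q, hq⟩, ?_⟩
    rw [LinearMap.comp_apply, ← sub_eq_zero, ← map_sub, Submodule.mkQ_apply,
      Submodule.Quotient.mk_eq_zero, Submodule.mem_comap]
    simpa using hp
  · intro q
    rw [LinearMap.comp_apply, Submodule.mkQ_apply, Submodule.Quotient.mk_eq_zero,
      Submodule.mem_comap]
    simp [q.2]

lemma relLength_anti {P R Q : Submodule A E} (hPR : P ≤ R) (hRQ : R ≤ Q) :
    relLength R Q ≤ relLength P Q := by
  rw [relLength_add hPR hRQ]
  exact le_add_self

lemma relLength_mono {P R Q : Submodule A E} (hPR : P ≤ R) (hRQ : R ≤ Q) :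
    relLength P R ≤ relLength P Q := by
  rw [relLength_add hPR hRQ]
  exact le_self_add

lemma toNat_relLength_add {P R Q : Submodule A E} (hPR : P ≤ R) (hRQ : R ≤ Q)
    (h : relLength P Q ≠ ⊤) :
    ((relLength P Q).toNat : ℤ) = (relLength P R).toNat + (relLength R Q).toNat := by
  have h1 := ne_top_of_le_ne_top h (relLength_mono hPR hRQ)
  have h2 := ne_top_of_le_ne_top h (relLength_anti hPR hRQ)
  rw [relLength_add hPR hRQ, ENat.toNat_add h1 h2]
  push_cast
  rfl

end RelLength

/-! ### The Hilbert-Serre theorem for families of subquotients -/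

section HilbertSerre

variable {A E : Type*} [CommRing A] [AddCommGroup E] [Module A E]

/-- Multiplication by `x ∈ s` maps `W n` into `W (n + 1)`. -/
def IsGradedStable (s : List A) (W : ℕ → Submodule A E) : Prop :=
  ∀ x ∈ s, ∀ n, ∀ e ∈ W n, x • e ∈ W (n + 1)

/-- The ascending chain condition for graded submodules, stable under `s`, of the graded module
with components `Q n / P n`. -/
def GradedNoetherian (s : List A) (P Q : ℕ → Submodule A E) : Prop :=
  ∀ W : ℕ → ℕ → Submodule A E, Monotone W → (∀ k, P ≤ W k) → (∀ k, W k ≤ Q) →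
    (∀ k, IsGradedStable s (W k)) → ∃ k₀, ∀ k, k₀ ≤ k → W k = W k₀

/-- **Hilbert-Serre theorem**: the length of the components of a Noetherian graded module over a
ring generated by `r` elements of degree one is eventually a polynomial of degree less than `r`. -/
theorem GradedNoetherian.eventuallyPoly (s : List A) (P Q : ℕ → Submodule A E) (hPQ : P ≤ Q)
    (hP : IsGradedStable s P) (hQ : IsGradedStable s Q) (hfin : ∀ n, relLength (P n) (Q n) ≠ ⊤)
    (acc : GradedNoetherian s P Q) :
    EventuallyPoly s.length (fun n => ((relLength (P n) (Q n)).toNat : ℤ)) := by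
  induction s generalizing P Q with
  | nil =>
    -- Without generators every family of submodules is stable, so the truncations in degrees below
    -- `k` form an admissible chain; its stopping forces `Q n = P n` for large `n`.
    obtain ⟨k₀, hk⟩ := acc (fun k n => if n < k then Q n else P n)
      (by
        intro k l hkl n
        dsimp only
        split_ifs with h1 h2
        · exact le_rfl
        · omega
        · exact hPQ n
        · exact le_rfl)
      (fun k n => by dsimp only; split_ifs; exacts [hPQ n, le_rfl])
      (fun k n => by dsimp only; split_ifs; exacts [le_rfl, hPQ n])
      (fun k x hx => by simp at hx)
    refine Filter.eventually_atTop.2 ⟨k₀, fun n hn => ?_⟩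
    have h := congrFun (hk (n + 1) (by omega)) n
    simp only [Nat.lt_succ_self, if_true, not_lt.2 hn, if_false] at h
    simp [relLength_eq_zero_iff.2 h.le]
  | cons x s ih =>
    let f : E →ₗ[A] E := LinearMap.lsmul A E x
    -- `K / P` and `Q(· + 1) / C` are the kernel and the cokernel of multiplication by `x` on `Q /
    -- P`. Since `x` kills both, `s` suffices as a set of generators for them.
    let K : ℕ → Submodule A E := fun n => Q n ⊓ (P (n + 1)).comap f
    let C : ℕ → Submodule A E := fun n => (Q n).map f ⊔ P (n + 1)
    have hPK : P ≤ K := fun n => le_inf (hPQ n) fun e he => hP x List.mem_cons_self n e he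
    have hKQ : K ≤ Q := fun n => inf_le_left
    have hPC : ∀ n, P (n + 1) ≤ C n := fun n => le_sup_right
    have hCQ : ∀ n, C n ≤ Q (n + 1) := fun n =>
      sup_le (Submodule.map_le_iff_le_comap.2 fun e he => hQ x List.mem_cons_self n e he)
        (hPQ (n + 1))
    have hK : IsGradedStable s K := by
      intro y hy n e he
      refine ⟨hQ y (List.mem_cons_of_mem _ hy) n e he.1, ?_⟩
      change x • y • e ∈ P (n + 1 + 1)
      rw [smul_comm]
      exact hP y (List.mem_cons_of_mem _ hy) (n + 1) _ he.2
    have hC : IsGradedStable s C := by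
      intro y hy n e he
      obtain ⟨_, ⟨q, hq, rfl⟩, p, hp, rfl⟩ := Submodule.mem_sup.1 he
      rw [smul_add]
      refine Submodule.add_mem_sup ⟨y • q, hQ y (List.mem_cons_of_mem _ hy) n q hq, ?_⟩
        (hP y (List.mem_cons_of_mem _ hy) (n + 1) p hp)
      rw [map_smul]
    have h1 := ih P K hPK (fun y hy => hP y (List.mem_cons_of_mem _ hy)) hK
      (fun n => ne_top_of_le_ne_top (hfin n) (relLength_mono (hPK n) (hKQ n)))
      (by
        intro W hW hPW hWK hWs
        refine acc W hW hPW (fun k => (hWK k).trans hKQ) fun k y hy n e he => ?_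
        rcases List.mem_cons.1 hy with rfl | hy
        · exact hPW k (n + 1) (hWK k n he).2
        · exact hWs k y hy n e he)
    have h2 := ih C (fun n => Q (n + 1)) hCQ hC
      (fun y hy n => hQ y (List.mem_cons_of_mem _ hy) (n + 1))
      (fun n => ne_top_of_le_ne_top (hfin (n + 1)) (relLength_anti (hPC n) (hCQ n)))
      (by
        intro W hW hCW hWQ hWs
        -- The cokernel lives in degrees shifted by one; padding with `P 0` in degree zero turns its
        -- chains into chains for the original pair.
        obtain ⟨k₀, hk⟩ := acc (fun k n => Nat.casesOn n (P 0) (W k))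
          (by
            intro k l hkl n
            cases n with
            | zero => exact le_rfl
            | succ n => exact hW hkl n)
          (by
            intro k n
            cases n with
            | zero => exact le_rfl
            | succ n => exact (hPC n).trans (hCW k n))
          (by
            intro k n
            cases n with
            | zero => exact hPQ 0
            | succ n => exact hWQ k n)
          (by
            intro k y hy n e he
            rcases List.mem_cons.1 hy with rfl | hy'
            · refine hCW k n (Submodule.mem_sup_left ⟨e, ?_, rfl⟩)
              cases n with
              | zero => exact hPQ 0 he
              | succ n => exact hWQ k n he
            · cases n with
              | zero => exact hCW k 0 (Submodule.mem_sup_right (hP y hy 0 e he))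
              | succ n => exact hWs k y hy' n e he)
        exact ⟨k₀, fun k hkk => funext fun n => congrFun (hk k hkk) (n + 1)⟩)
    refine EventuallyPoly.congr (r := s.length) (Filter.Eventually.of_forall fun n => ?_)
      (h2.sub h1)
    have e1 := toNat_relLength_add (hPK n) (hKQ n) (hfin n)
    have e2 := toNat_relLength_add (hPC n) (hCQ n) (hfin (n + 1))
    have e3 : relLength (K n) (Q n) = relLength (P (n + 1)) (C n) :=
      relLength_comap_inf f (P (n + 1)) (Q n)
    rw [e3] at e1
    linarith

/-- Between `F.N (n + 1)` and `F.N n`, each member of a chain is itself a filtration. The union of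
the chain lies below a stable filtration, hence is stable and determined by finitely many degrees.
In each of these the chain stops because `E` is Noetherian. -/
lemma Ideal.Filtration.Stable.gradedNoetherian [IsNoetherianRing A] [Module.Finite A E]
    {s : List A} {F : (Ideal.ofList s).Filtration E} (hF : F.Stable) :
    GradedNoetherian s (fun n => F.N (n + 1)) F.N := by
  intro W hW hPW hWQ hWs
  have hsmul : ∀ k n, Ideal.ofList s • W k n ≤ W k (n + 1) := by
    intro k n
    refine Submodule.smul_le.2 fun r hr e he => ?_
    induction hr using Submodule.span_induction with
    | mem x hx => exact hWs k x hx n e he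
    | zero => rw [zero_smul]; exact zero_mem _
    | add x y _ _ hx hy => rw [add_smul]; exact add_mem hx hy
    | smul a x _ hx => rw [smul_assoc]; exact Submodule.smul_mem _ _ hx
  let G : ℕ → (Ideal.ofList s).Filtration E := fun k =>
    ⟨W k, fun n => (hWQ k (n + 1)).trans (hPW k n), hsmul k⟩
  let H : (Ideal.ofList s).Filtration E := ⨆ k, G k
  have hHN : H.N = ⨆ k, W k := Ideal.Filtration.iSup_N G
  have hHn : ∀ n, H.N n = ⨆ k, W k n := fun n => by rw [hHN, iSup_apply]
  have hH : H.Stable := by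
    refine hF.of_le fun n => ?_
    change H.N n ≤ F.N n
    rw [hHn]
    exact iSup_le fun k => hWQ k n
  obtain ⟨n₀, hn₀⟩ := hH
  have hstab : ∀ n, ∃ k, H.N n ≤ W k n := by
    intro n
    obtain ⟨k, hk⟩ := monotone_stabilizes_iff_noetherian.2 (inferInstance : IsNoetherian A E)
      ⟨fun k => W k n, fun k l hkl => hW hkl n⟩
    refine ⟨k, ?_⟩
    rw [hHn]
    refine iSup_le fun l => ?_
    rcases le_total l k with h | h
    · exact hW h n
    · exact (hk l h).ge
  choose κ hκ using hstab
  have hκ' : ∀ n, H.N n ≤ W ((Finset.range (n₀ + 1)).sup κ) n := by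
    intro n
    rcases le_total n n₀ with h | h
    · exact (hκ n).trans (hW (Finset.le_sup (f := κ) (Finset.mem_range.2 (by omega))) n)
    · induction n, h using Nat.le_induction with
      | base => exact (hκ n₀).trans (hW (Finset.le_sup (f := κ) (Finset.mem_range.2 (by omega))) n₀)
      | succ n hn ih =>
        rw [← hn₀ n hn]
        exact (Submodule.smul_mono le_rfl ih).trans (hsmul _ n)
  refine ⟨(Finset.range (n₀ + 1)).sup κ, fun k hk => le_antisymm (fun n => ?_) (hW hk)⟩
  refine le_trans ?_ (hκ' n)
  rw [hHn]
  exact le_iSup (fun k => W k n) k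

/-- The lengths of the components of the associated graded module of a stable filtration. -/
lemma Ideal.Filtration.Stable.eventuallyPoly [IsNoetherianRing A] [Module.Finite A E]
    {I : Ideal A} {F : I.Filtration E} (hF : F.Stable)
    (hfin : ∀ n, relLength (F.N (n + 1)) (F.N n) ≠ ⊤) :
    ∃ r, EventuallyPoly r (fun n => ((relLength (F.N (n + 1)) (F.N n)).toNat : ℤ)) := by
  obtain ⟨t, ht⟩ := IsNoetherian.noetherian I
  obtain rfl : Ideal.ofList t.toList = I := by
    rw [← ht]
    exact congrArg Ideal.span (Set.ext fun x => Finset.mem_toList)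
  have hs : ∀ x ∈ t.toList, ∀ n, ∀ e ∈ F.N n, x • e ∈ F.N (n + 1) := fun x hx n e he =>
    F.smul_le n (Submodule.smul_mem_smul (Ideal.subset_span hx) he)
  exact ⟨_, GradedNoetherian.eventuallyPoly _ _ _ F.mono (fun x hx n e he => hs x hx (n + 1) e he)
    hs hfin hF.gradedNoetherian⟩

/-- The **Hilbert-Samuel polynomial** of a stable filtration. -/
lemma Ideal.Filtration.Stable.eventuallyPoly_relLength_zero [IsNoetherianRing A] [Module.Finite A E]
    {I : Ideal A} {F : I.Filtration E} (hF : F.Stable)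
    (hfin : ∀ n, relLength (F.N n) (F.N 0) ≠ ⊤) :
    ∃ r, EventuallyPoly r (fun n => ((relLength (F.N n) (F.N 0)).toNat : ℤ)) := by
  obtain ⟨r, hr⟩ := hF.eventuallyPoly fun n => ne_top_of_le_ne_top (hfin (n + 1))
    (relLength_mono (F.mono n) (F.antitone (Nat.zero_le n)))
  refine ⟨r + 1, EventuallyPoly.congr (r := r) (Filter.Eventually.of_forall fun n => ?_) hr⟩
  have := toNat_relLength_add (F.mono n) (F.antitone (Nat.zero_le n)) (hfin (n + 1))
  linarith

end HilbertSerre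

/-! ### Hilbert-Samuel functions, parameters and regular sequences -/

section HilbertSamuel

open Pointwise

variable {A : Type*} [CommRing A] [IsLocalRing A] [IsNoetherianRing A]
  {L : Type*} [AddCommGroup L] [Module A L] [Module.Finite A L]

lemma length_quotient_pow_smul_top_ne_top (n : ℕ) :
    Module.length A (L ⧸ maximalIdeal A ^ n • (⊤ : Submodule A L)) ≠ ⊤ := by
  let I := maximalIdeal A ^ n
  have hB : IsArtinianRing (A ⧸ I) := by
    rcases subsingleton_or_nontrivial (A ⧸ I) with h | h
    · infer_instance
    · have : IsLocalRing (A ⧸ I) := .of_surjective' _ Ideal.Quotient.mk_surjective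
      rw [isArtinianRing_iff_isNilpotent_maximalIdeal]
      refine ⟨n, ?_⟩
      have hm : maximalIdeal (A ⧸ I) = (maximalIdeal A).map (Ideal.Quotient.mk I) :=
        (IsLocalRing.map_maximalIdeal_of_surjective _ Ideal.Quotient.mk_surjective).symm
      rw [hm, ← Ideal.map_pow, Ideal.zero_eq_bot, Ideal.map_quotient_self]
  have : Module.Finite (A ⧸ I) (L ⧸ I • (⊤ : Submodule A L)) :=
    Module.Finite.of_restrictScalars_finite A _ _
  rw [Module.length_eq_of_surjective (R := A ⧸ I) Ideal.Quotient.mk_surjective]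
  exact Module.length_ne_top

variable (A L) in
/-- The Hilbert-Samuel function of a module over a local ring. -/
noncomputable def hilbertSamuel (n : ℕ) : ℤ :=
  (Module.length A (L ⧸ maximalIdeal A ^ n • (⊤ : Submodule A L))).toNat

omit [IsLocalRing A] [IsNoetherianRing A] [Module.Finite A L] in
lemma relLength_top (P : Submodule A L) : relLength P ⊤ = Module.length A (L ⧸ P) :=
  relLength_eq_of_surjective (P.mkQ ∘ₗ (⊤ : Submodule A L).subtype)
    (fun z => by
      obtain ⟨z, rfl⟩ := P.mkQ_surjective z
      exact ⟨⟨z, trivial⟩, rfl⟩)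
    fun q => Submodule.Quotient.mk_eq_zero P

omit [IsLocalRing A] [IsNoetherianRing A] [Module.Finite A L] in
lemma relLength_smul_self (I : Ideal A) (N : Submodule A L) :
    relLength (I • N) N = Module.length A (N ⧸ I • (⊤ : Submodule A N)) := by
  have h : (I • N).comap N.subtype = I • (⊤ : Submodule A N) := by
    have : (I • (⊤ : Submodule A N)).map N.subtype = I • N := by
      rw [Submodule.map_smul'', Submodule.map_top, Submodule.range_subtype]
    rw [← this, Submodule.comap_map_eq_of_injective N.subtype_injective]
  rw [relLength, h]

lemma exists_eventuallyPoly_hilbertSamuel : ∃ r, EventuallyPoly r (hilbertSamuel A L) := by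
  have h := ((maximalIdeal A).stableFiltration_stable
    (⊤ : Submodule A L)).eventuallyPoly_relLength_zero
  simp only [Ideal.stableFiltration, pow_zero, Ideal.one_eq_top, Submodule.top_smul,
    relLength_top] at h
  exact h length_quotient_pow_smul_top_ne_top

omit [IsNoetherianRing A] [Module.Finite A L] in
lemma hilbertSamuel_nonneg (n : ℕ) : 0 ≤ hilbertSamuel A L n := Int.natCast_nonneg _

lemma hilbertSamuel_mono {n k : ℕ} (h : n ≤ k) : hilbertSamuel A L n ≤ hilbertSamuel A L k := by
  have := ENat.toNat_le_toNat (Module.length_le_of_surjective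
    (Submodule.factor (Submodule.smul_mono_left (N := (⊤ : Submodule A L)) (Ideal.pow_le_pow_right h)))
    (Submodule.factor_surjective _)) (length_quotient_pow_smul_top_ne_top (A := A) k)
  exact Int.ofNat_le.2 this

/-- The length of `L / (𝔪ⁿ L : x)`. -/
lemma hilbertSamuel_quotSMulTop (x : A) (n : ℕ) :
    hilbertSamuel A L n = (Module.length A (L ⧸ (maximalIdeal A ^ n • (⊤ : Submodule A L)).comap
      (LinearMap.lsmul A L x))).toNat + hilbertSamuel A (QuotSMulTop x L) n := by
  set P := maximalIdeal A ^ n • (⊤ : Submodule A L) with hP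
  have hfin := length_quotient_pow_smul_top_ne_top (A := A) (L := L) n
  have h1 := relLength_comap_inf (LinearMap.lsmul A L x) P ⊤
  rw [top_inf_eq, relLength_top] at h1
  have h2 : relLength ((⊤ : Submodule A L).map (LinearMap.lsmul A L x) ⊔ P) ⊤ =
      Module.length A (QuotSMulTop x L ⧸
        maximalIdeal A ^ n • (⊤ : Submodule A (QuotSMulTop x L))) := by
    refine relLength_eq_of_surjective ((Submodule.mkQ _) ∘ₗ (Submodule.mkQ _) ∘ₗ
      (⊤ : Submodule A L).subtype) ?_ ?_
    · intro z
      obtain ⟨z, rfl⟩ := Submodule.mkQ_surjective _ z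
      obtain ⟨z, rfl⟩ := Submodule.mkQ_surjective _ z
      exact ⟨⟨z, trivial⟩, rfl⟩
    · intro q
      rw [LinearMap.comp_apply, LinearMap.comp_apply, Submodule.mkQ_apply,
        Submodule.Quotient.mk_eq_zero, ← Submodule.mem_comap,
        Submodule.comap_smul_top_of_surjective _ _ (Submodule.mkQ_surjective _),
        Submodule.ker_mkQ, sup_comm]
      rfl
  have h3 := toNat_relLength_add (P := P) (Q := ⊤) (le_sup_right :
    P ≤ (⊤ : Submodule A L).map (LinearMap.lsmul A L x) ⊔ P) le_top (by rwa [relLength_top])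
  rw [relLength_top, ← h1, h2] at h3
  exact h3

/-- Since `𝔪ⁿL ⊆ (𝔪ⁿ⁺¹L : x)`, the first difference for `L` is at most the Hilbert-Samuel function
of `L/xL`. -/
lemma EventuallyPoly.hilbertSamuel_of_quotSMulTop {x : A} (hx : x ∈ maximalIdeal A) {r : ℕ}
    (h : EventuallyPoly r (hilbertSamuel A (QuotSMulTop x L))) :
    EventuallyPoly (r + 1) (hilbertSamuel A L) := by
  obtain ⟨R, hR⟩ := exists_eventuallyPoly_hilbertSamuel (A := A) (L := L)
  refine EventuallyPoly.of_le (r := R) (k := r) (f := fun n => hilbertSamuel A L (n + 1) - hilbertSamuel A L n)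
    hR.succ (h.shift 1)
    (Filter.Eventually.of_forall fun n => ?_) (Filter.Eventually.of_forall fun n => ?_)
  · exact sub_nonneg.2 (hilbertSamuel_mono n.le_succ)
  · rw [hilbertSamuel_quotSMulTop x (n + 1)]
    have hle : maximalIdeal A ^ n • (⊤ : Submodule A L) ≤
        (maximalIdeal A ^ (n + 1) • (⊤ : Submodule A L)).comap (LinearMap.lsmul A L x) := by
      intro e he
      rw [Submodule.mem_comap, pow_succ', mul_smul]
      exact Submodule.smul_mem_smul hx he
    have := ENat.toNat_le_toNat (Module.length_le_of_surjective (Submodule.factor hle)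
      (Submodule.factor_surjective _)) (length_quotient_pow_smul_top_ne_top n)
    have h' : ((Module.length A (L ⧸ (maximalIdeal A ^ (n + 1) • (⊤ : Submodule A L)).comap
      (LinearMap.lsmul A L x))).toNat : ℤ) ≤ hilbertSamuel A L n :=
      Int.ofNat_le.2 this
    linarith

/-- For regular `x`, Artin-Rees gives `(𝔪ⁿ⁺ᶜL : x) ⊆ 𝔪ⁿL`, so the function of `L/xL` at `n + c` is
at most a difference of values for `L` and loses a degree. -/
lemma EventuallyPoly.hilbertSamuel_quotSMulTop {x : A} (hx : IsSMulRegular L x) {r : ℕ}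
    (h : EventuallyPoly (r + 1) (hilbertSamuel A L)) :
    EventuallyPoly r (hilbertSamuel A (QuotSMulTop x L)) := by
  obtain ⟨R, hR⟩ := exists_eventuallyPoly_hilbertSamuel (A := A) (L := QuotSMulTop x L)
  obtain ⟨c, hc⟩ := Ideal.exists_pow_inf_eq_pow_smul (maximalIdeal A)
    (LinearMap.range (LinearMap.lsmul A L x))
  refine EventuallyPoly.of_shift c (EventuallyPoly.of_le (hR.shift c) (h.shift_sub c)
    (Filter.Eventually.of_forall fun n => hilbertSamuel_nonneg _)
    (Filter.Eventually.of_forall fun n => ?_))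
  rw [_root_.hilbertSamuel_quotSMulTop (L := L) x (n + c)]
  have hle : (maximalIdeal A ^ (n + c) • (⊤ : Submodule A L)).comap (LinearMap.lsmul A L x) ≤
      maximalIdeal A ^ n • (⊤ : Submodule A L) := by
    intro e he
    have h1 : x • e ∈ maximalIdeal A ^ (n + c) • (⊤ : Submodule A L) ⊓
      LinearMap.range (LinearMap.lsmul A L x) := ⟨he, e, rfl⟩
    rw [hc _ (Nat.le_add_left c n), Nat.add_sub_cancel] at h1
    have h2 := Submodule.smul_mono le_rfl inf_le_right h1
    rw [← Submodule.map_top, ← Submodule.map_smul''] at h2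
    obtain ⟨e', he', hee⟩ := h2
    rwa [← hx hee]
  have hfin : Module.length A (L ⧸ (maximalIdeal A ^ (n + c) • (⊤ : Submodule A L)).comap
      (LinearMap.lsmul A L x)) ≠ ⊤ := by
    refine ne_top_of_le_ne_top (length_quotient_pow_smul_top_ne_top (A := A) (L := L) (n + c))
      (Module.length_le_of_surjective (Submodule.factor fun e he => ?_)
        (Submodule.factor_surjective _))
    exact Submodule.smul_mem _ x he
  have := ENat.toNat_le_toNat (Module.length_le_of_surjective (Submodule.factor hle)
    (Submodule.factor_surjective _)) hfin
  have h' : hilbertSamuel A L n ≤ ((Module.length A (L ⧸ (maximalIdeal A ^ (n + c) •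
    (⊤ : Submodule A L)).comap (LinearMap.lsmul A L x))).toNat : ℤ) :=
    Int.ofNat_le.2 this
  linarith

lemma eventuallyPoly_hilbertSamuel_of_pow_smul_le {rs : List A}
    (hrs : ∀ r ∈ rs, r ∈ maximalIdeal A) {k : ℕ}
    (hk : maximalIdeal A ^ k • (⊤ : Submodule A L) ≤ Ideal.ofList rs • ⊤) :
    EventuallyPoly (rs.length + 1) (hilbertSamuel A L) := by
  induction rs generalizing L with
  | nil =>
    rw [Ideal.ofList_nil, Submodule.bot_smul, le_bot_iff] at hk
    have h : ∀ n, k ≤ n → maximalIdeal A ^ n • (⊤ : Submodule A L) = ⊥ := fun n hn =>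
      le_bot_iff.1 (hk ▸ Submodule.smul_mono_left (Ideal.pow_le_pow_right hn))
    refine Filter.eventually_atTop.2 ⟨k, fun n hn => ?_⟩
    dsimp only [hilbertSamuel]
    rw [h n hn, h (n + 1) (by omega), sub_self]
  | cons x rs ih =>
    refine EventuallyPoly.hilbertSamuel_of_quotSMulTop (hrs x List.mem_cons_self)
      (ih (fun r hr => hrs r (List.mem_cons_of_mem _ hr)) ?_)
    have h := Submodule.map_mono (f := (x • (⊤ : Submodule A L)).mkQ) hk
    have htop : (⊤ : Submodule A L).map (x • (⊤ : Submodule A L)).mkQ = ⊤ := by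
      rw [Submodule.map_top, Submodule.range_mkQ]
    rw [Ideal.ofList_cons_smul, Submodule.map_sup, Submodule.map_smul'', Submodule.map_smul'',
      htop] at h
    refine h.trans (sup_le ?_ le_rfl)
    rintro _ ⟨e, he, rfl⟩
    rw [Submodule.mkQ_apply, (Submodule.Quotient.mk_eq_zero (x • (⊤ : Submodule A L))).2 he]
    exact zero_mem _

lemma EventuallyPoly.length_lt_of_isWeaklyRegular [Nontrivial L] {rs : List A}
    (hrs : ∀ r ∈ rs, r ∈ maximalIdeal A) (hreg : RingTheory.Sequence.IsWeaklyRegular L rs)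
    {r : ℕ} (h : EventuallyPoly r (hilbertSamuel A L)) : rs.length < r := by
  -- By Nakayama, `N = 𝔪ⁿ⁺¹N` is impossible for `N ≠ 0`, so the function of a nonzero module never
  -- vanishes eventually.
  have h0 : ∀ (N : Type _) [AddCommGroup N] [Module A N] [Module.Finite A N] [Nontrivial N],
      ¬ EventuallyPoly 0 (hilbertSamuel A N) := by
    intro N _ _ _ _ h0
    obtain ⟨n, hn⟩ := Filter.eventually_atTop.1 (h0 : ∀ᶠ n in Filter.atTop, hilbertSamuel A N n = 0)
    have h1 := hn (n + 1) (by omega)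
    rw [hilbertSamuel, Nat.cast_eq_zero, ENat.toNat_eq_zero,
      or_iff_left (length_quotient_pow_smul_top_ne_top _), Module.length_eq_zero_iff,
      Submodule.Quotient.subsingleton_iff] at h1
    have h2 : (⊤ : Submodule A N) ≤ maximalIdeal A • ⊤ := by
      conv_lhs => rw [← h1]
      exact Submodule.smul_mono (Ideal.pow_le_self (by omega)) le_rfl
    have h3 := Submodule.eq_bot_of_le_smul_of_le_jacobson_bot _ _ Module.Finite.fg_top h2
      (IsLocalRing.maximalIdeal_le_jacobson _)
    exact top_ne_bot h3
  induction rs generalizing L r with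
  | nil =>
    rcases Nat.eq_zero_or_pos r with rfl | hr
    · exact absurd h (h0 L)
    · exact hr
  | cons x rs ih =>
    rw [RingTheory.Sequence.isWeaklyRegular_cons_iff] at hreg
    have hx := hrs x List.mem_cons_self
    have : Nontrivial (QuotSMulTop x L) := nontrivial_quotSMulTop_of_mem_maximalIdeal L hx
    cases r with
    | zero => exact absurd h (h0 L)
    | succ r =>
      have := ih (fun r hr => hrs r (List.mem_cons_of_mem _ hr)) hreg.2
        (h.hilbertSamuel_quotSMulTop hreg.1)
      simpa using this

end HilbertSamuel

/-! ### Growth of `(L ∩ 𝔪ⁿF)/𝔪ⁿL` -/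

section Syzygy

variable {A : Type*} [CommRing A] [IsLocalRing A] [IsNoetherianRing A]
  {F : Type*} [AddCommGroup F] [Module A F] [Module.Finite A F] (L : Submodule A F)

omit [IsNoetherianRing A] [Module.Finite A F] in
lemma toNat_relLength_pow_smul (n : ℕ) :
    ((relLength (maximalIdeal A ^ n • L) L).toNat : ℤ) = hilbertSamuel A L n := by
  rw [relLength_smul_self]
  rfl

lemma relLength_pow_smul_ne_top (n : ℕ) : relLength (maximalIdeal A ^ n • L) L ≠ ⊤ := by
  rw [relLength_smul_self]
  exact length_quotient_pow_smul_top_ne_top n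

omit [IsLocalRing A] [IsNoetherianRing A] [Module.Finite A F] in
lemma smul_le_inf_smul_top (I : Ideal A) : I • L ≤ L ⊓ I • ⊤ :=
  le_inf Submodule.smul_le_right (Submodule.smul_mono le_rfl le_top)

lemma relLength_pow_smul_inf_ne_top (n : ℕ) :
    relLength (maximalIdeal A ^ n • L) (L ⊓ maximalIdeal A ^ n • ⊤) ≠ ⊤ :=
  ne_top_of_le_ne_top (relLength_pow_smul_ne_top L n)
    (relLength_mono (smul_le_inf_smul_top L _) inf_le_left)

/-- The length is that of `L/𝔪ⁿL` minus that of `L/(L ∩ 𝔪ⁿF)`; both filtrations are stable, the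
second by Artin-Rees. -/
lemma exists_eventuallyPoly_relLength_inf : ∃ r, EventuallyPoly r (fun n =>
    ((relLength (maximalIdeal A ^ n • L) (L ⊓ maximalIdeal A ^ n • ⊤)).toNat : ℤ)) := by
  have h := ((maximalIdeal A).stableFiltration_stable (⊤ : Submodule A F)).inter_left
    (F' := (maximalIdeal A).trivialFiltration L)
  have hN : ∀ n, ((maximalIdeal A).trivialFiltration L ⊓
      (maximalIdeal A).stableFiltration (⊤ : Submodule A F)).N n =
      L ⊓ maximalIdeal A ^ n • ⊤ := fun n => rfl
  have h' := h.eventuallyPoly_relLength_zero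
  simp only [hN, pow_zero, Ideal.one_eq_top, Submodule.top_smul, inf_top_eq] at h'
  obtain ⟨r, hr⟩ := h' fun n => ne_top_of_le_ne_top (relLength_pow_smul_ne_top L n)
    (relLength_anti (smul_le_inf_smul_top L _) inf_le_left)
  obtain ⟨s, hs⟩ := exists_eventuallyPoly_hilbertSamuel (A := A) (L := L)
  refine ⟨max r s, EventuallyPoly.congr (Filter.Eventually.of_forall fun n => ?_)
    ((hs.mono (le_max_right r s)).sub (hr.mono (le_max_left r s)))⟩
  rw [← toNat_relLength_pow_smul, toNat_relLength_add (smul_le_inf_smul_top L _) inf_le_left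
    (relLength_pow_smul_ne_top L n)]
  ring

lemma EventuallyPoly.relLength_inf {d : ℕ} (h : EventuallyPoly (d + 1) (hilbertSamuel A L)) :
    EventuallyPoly d (fun n =>
      ((relLength (maximalIdeal A ^ n • L) (L ⊓ maximalIdeal A ^ n • ⊤)).toNat : ℤ)) := by
  obtain ⟨R, hR⟩ := exists_eventuallyPoly_relLength_inf L
  obtain ⟨c, hc⟩ := Ideal.exists_pow_inf_eq_pow_smul (maximalIdeal A) L
  refine EventuallyPoly.of_shift c (EventuallyPoly.of_le (hR.shift c) (h.shift_sub c)
    (Filter.Eventually.of_forall fun n => Int.natCast_nonneg _)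
    (Filter.Eventually.of_forall fun n => ?_))
  have h1 : L ⊓ maximalIdeal A ^ (n + c) • ⊤ ≤ maximalIdeal A ^ n • L := by
    rw [inf_comm, hc _ (Nat.le_add_left c n), Nat.add_sub_cancel]
    exact Submodule.smul_mono le_rfl inf_le_right
  have h2 := toNat_relLength_add (smul_le_inf_smul_top L (maximalIdeal A ^ (n + c))) h1
    (ne_top_of_le_ne_top (relLength_pow_smul_ne_top L (n + c)) (relLength_mono
      ((smul_le_inf_smul_top L _).trans h1) Submodule.smul_le_right))
  have h3 := toNat_relLength_add ((smul_le_inf_smul_top L _).trans h1) Submodule.smul_le_right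
    (relLength_pow_smul_ne_top L (n + c))
  rw [toNat_relLength_pow_smul, toNat_relLength_pow_smul] at h3
  linarith [Int.natCast_nonneg (relLength (L ⊓ maximalIdeal A ^ (n + c) • ⊤)
    (maximalIdeal A ^ n • L)).toNat]

/-- Minimality gives `𝔪ⁿL ⊆ L ∩ 𝔪ⁿ⁺¹F`, so `𝔪ⁿL/𝔪ⁿ⁺¹L` sits inside the subquotient in degree `n +
1`. This is the bound opposite to the Artin-Rees one. -/
lemma EventuallyPoly.hilbertSamuel_of_relLength_inf (hL : L ≤ maximalIdeal A • ⊤) {r : ℕ}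
    (h : EventuallyPoly r (fun n =>
      ((relLength (maximalIdeal A ^ n • L) (L ⊓ maximalIdeal A ^ n • ⊤)).toNat : ℤ))) :
    EventuallyPoly (r + 1) (hilbertSamuel A L) := by
  obtain ⟨R, hR⟩ := exists_eventuallyPoly_hilbertSamuel (A := A) (L := L)
  refine EventuallyPoly.of_le (r := R) (k := r) (f := fun n => hilbertSamuel A L (n + 1) - hilbertSamuel A L n)
    hR.succ (h.shift 1)
    (Filter.Eventually.of_forall fun n => ?_) (Filter.Eventually.of_forall fun n => ?_)
  · exact sub_nonneg.2 (hilbertSamuel_mono n.le_succ)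
  · have h1 : maximalIdeal A ^ (n + 1) • L ≤ maximalIdeal A ^ n • L :=
      Submodule.smul_mono_left (Ideal.pow_le_pow_right n.le_succ)
    have h2 : maximalIdeal A ^ n • L ≤ L ⊓ maximalIdeal A ^ (n + 1) • ⊤ := by
      refine le_inf Submodule.smul_le_right ?_
      rw [pow_succ, mul_smul]
      exact Submodule.smul_mono le_rfl hL
    have h3 := toNat_relLength_add h1 Submodule.smul_le_right (relLength_pow_smul_ne_top L (n + 1))
    rw [toNat_relLength_pow_smul, toNat_relLength_pow_smul] at h3
    have h4 := ENat.toNat_le_toNat (relLength_mono h1 h2) (relLength_pow_smul_inf_ne_top L (n + 1))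
    have h5 : ((relLength (maximalIdeal A ^ (n + 1) • L) (maximalIdeal A ^ n • L)).toNat : ℤ) ≤
      (relLength (maximalIdeal A ^ (n + 1) • L) (L ⊓ maximalIdeal A ^ (n + 1) • ⊤)).toNat := by
      exact_mod_cast h4
    linarith

end Syzygy

/-! ### Balancing `Tor₁` -/

section KernelLength

variable {A : Type*} [CommRing A] {X Y Z T : Type*} [AddCommGroup X] [Module A X]
  [AddCommGroup Y] [Module A Y] [AddCommGroup Z] [Module A Z] [AddCommGroup T] [Module A T]

lemma relLength_map_of_injective {b : X →ₗ[A] Z} (hb : Function.Injective b)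
    (P Q : Submodule A X) : relLength (P.map b) (Q.map b) = relLength P Q := by
  refine (relLength_eq_of_surjective (((P.map b).comap (Q.map b).subtype).mkQ ∘ₗ
    (Submodule.equivMapOfInjective b hb Q).toLinearMap) ?_ ?_).symm
  · exact (Submodule.mkQ_surjective _).comp (LinearEquiv.surjective _)
  · intro q
    rw [LinearMap.comp_apply, Submodule.mkQ_apply, Submodule.Quotient.mk_eq_zero,
      Submodule.mem_comap]
    exact hb.mem_set_image

/-- Surjectivity of `a` gives `ker c ≅ ker (c ∘ a) / ker a`, and the injection `b` moves this
subquotient into `Z`. Kernels of unrelated maps become comparable inside one module. -/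
lemma length_ker_eq_relLength {a : X →ₗ[A] Y} {b : X →ₗ[A] Z} {c : Y →ₗ[A] T} {q : Z →ₗ[A] T}
    (ha : Function.Surjective a) (hb : Function.Injective b) (h : q ∘ₗ b = c ∘ₗ a) :
    Module.length A (LinearMap.ker c) =
      relLength ((LinearMap.ker a).map b) (LinearMap.ker q ⊓ LinearMap.range b) := by
  have h1 : LinearMap.ker q ⊓ LinearMap.range b = (LinearMap.ker (c ∘ₗ a)).map b := by
    rw [← h, LinearMap.ker_comp, inf_comm, ← Submodule.map_comap_eq]
  rw [h1, relLength_map_of_injective hb]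
  refine (relLength_eq_of_surjective ((a ∘ₗ (LinearMap.ker (c ∘ₗ a)).subtype).codRestrict _
    fun x => x.2) ?_ ?_).symm
  · rintro ⟨y, hy⟩
    obtain ⟨x, rfl⟩ := ha y
    exact ⟨⟨x, hy⟩, rfl⟩
  · intro q
    rw [← Subtype.coe_inj]
    rfl

open TensorProduct in
/-- Balancing `Tor₁`: it can be computed from a presentation of either argument. -/
lemma length_ker_lTensor_eq_length_ker_rTensor {M F P N : Type*} [AddCommGroup M] [Module A M]
    [AddCommGroup F] [Module A F] [AddCommGroup P] [Module A P] [AddCommGroup N] [Module A N]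
    [Module.Flat A F] [Module.Flat A P] (π : F →ₗ[A] M) (hπ : Function.Surjective π)
    (ε : P →ₗ[A] N) (hε : Function.Surjective ε) :
    Module.length A (LinearMap.ker ((LinearMap.ker ε).subtype.lTensor M)) =
      Module.length A (LinearMap.ker ((LinearMap.ker π).subtype.rTensor N)) := by
  set K := LinearMap.ker ε
  set L := LinearMap.ker π
  have e1 : Function.Exact L.subtype π := π.exact_subtype_ker_map
  have e2 : Function.Exact K.subtype ε := ε.exact_subtype_ker_map
  -- Inside `F ⊗ P`, both kernels become the intersection of the images of `L ⊗ P` and `F ⊗ K`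
  -- modulo the image of `L ⊗ K`.
  rw [length_ker_eq_relLength (a := π.rTensor K) (b := K.subtype.lTensor F) (q := π.rTensor P)
      (LinearMap.rTensor_surjective _ hπ)
      (Module.Flat.lTensor_preserves_injective_linearMap _ K.subtype_injective)
      (TensorProduct.ext' fun _ _ => rfl),
    length_ker_eq_relLength (a := ε.lTensor L) (b := L.subtype.rTensor P) (q := ε.lTensor F)
      (LinearMap.lTensor_surjective _ hε)
      (Module.Flat.rTensor_preserves_injective_linearMap _ L.subtype_injective)
      (TensorProduct.ext' fun _ _ => rfl),
    (rTensor_exact K e1 hπ).linearMap_ker_eq, (rTensor_exact P e1 hπ).linearMap_ker_eq,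
    (lTensor_exact L e2 hε).linearMap_ker_eq, (lTensor_exact F e2 hε).linearMap_ker_eq,
    inf_comm, ← LinearMap.range_comp, ← LinearMap.range_comp,
    LinearMap.lTensor_comp_rTensor, LinearMap.rTensor_comp_lTensor]

open TensorProduct in
lemma length_ker_rTensor_quotient {F : Type*} [AddCommGroup F] [Module A F] (L : Submodule A F)
    (I : Ideal A) : Module.length A (LinearMap.ker (L.subtype.rTensor (A ⧸ I))) =
      relLength (I • L) (L ⊓ I • ⊤) := by
  rw [length_ker_eq_relLength (b := L.subtype)
      (a := (tensorQuotEquivQuotSMul L I).symm.toLinearMap ∘ₗ (I • (⊤ : Submodule A L)).mkQ)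
      (q := (tensorQuotEquivQuotSMul F I).symm.toLinearMap ∘ₗ (I • (⊤ : Submodule A F)).mkQ)
      ((LinearEquiv.surjective (tensorQuotEquivQuotSMul L I).symm).comp
        (Submodule.mkQ_surjective _)) L.subtype_injective
      (LinearMap.ext fun _ => rfl), LinearEquiv.ker_comp, LinearEquiv.ker_comp,
    Submodule.ker_mkQ, Submodule.ker_mkQ, Submodule.range_subtype, Submodule.map_smul'',
    Submodule.map_top, Submodule.range_subtype, inf_comm]

end KernelLength

/-! ### `Tor₁` as the kernel of a tensored inclusion -/

section Tor

variable {A : Type u} [CommRing A]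

/-- `Tor₁` computed from a projective presentation of the second argument. -/
lemma exists_length_tor_one_eq (X : ModuleCat.{u} A) :
    ∃ (P : ModuleCat.{u} A) (_ : Projective P) (ε : P →ₗ[A] X), Function.Surjective ε ∧
      ∀ M : ModuleCat.{u} A, Module.length A (((Tor (ModuleCat.{u} A) 1).obj M).obj X) =
        Module.length A (LinearMap.ker ((LinearMap.ker ε).subtype.lTensor M)) := by
  let R : ProjectiveResolution X := ProjectiveResolution.of X
  let ε : R.complex.X 0 →ₗ[A] X := (R.π.f 0).hom
  have hε : Function.Surjective ε := (ModuleCat.epi_iff_surjective (R.π.f 0)).1 inferInstance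
  refine ⟨R.complex.X 0, inferInstance, ε, hε, fun M => ?_⟩
  let d₁ : R.complex.X 1 →ₗ[A] R.complex.X 0 := (R.complex.d 1 0).hom
  let d₂ : R.complex.X 2 →ₗ[A] R.complex.X 1 := (R.complex.d 2 1).hom
  have ex0 : Function.Exact d₁ ε :=
    (ShortComplex.ShortExact.moduleCat_exact_iff_function_exact _).1 R.exact₀
  have ex1 : Function.Exact d₂ d₁ :=
    (ShortComplex.ShortExact.moduleCat_exact_iff_function_exact _).1 (R.exact_succ 0)
  let C := ((MonoidalCategory.tensoringLeft (ModuleCat.{u} A)).obj M).mapHomologicalComplex _ |>.obj R.complex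
  let e : ((Tor (ModuleCat.{u} A) 1).obj M).obj X ≅ _ :=
    R.isoLeftDerivedObj ((MonoidalCategory.tensoringLeft (ModuleCat.{u} A)).obj M) 1 ≪≫
      ShortComplex.homologyMapIso (C.isoSc' 2 1 0 (by simp) (by simp)) ≪≫
      (C.sc' 2 1 0).moduleCatHomologyIso
  have hrange : LinearMap.range d₁ = LinearMap.ker ε := ex0.linearMap_ker_eq.symm
  let d : R.complex.X 1 →ₗ[A] LinearMap.ker ε := d₁.codRestrict _ fun x =>
    hrange.le ⟨x, rfl⟩
  have hd : Function.Surjective d := by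
    rintro ⟨x, hx⟩
    obtain ⟨y, rfl⟩ := hrange.ge hx
    exact ⟨y, rfl⟩
  have exd : Function.Exact d₂ d := fun x => by
    rw [← ex1 x, ← Subtype.coe_inj]
    rfl
  have hd₁ : d₁.lTensor M = (LinearMap.ker ε).subtype.lTensor M ∘ₗ d.lTensor M := by
    rw [← LinearMap.lTensor_comp]
    rfl
  have hker : (C.sc' 2 1 0).g.hom = d₁.lTensor M := rfl
  -- By right exactness, `M ⊗ R₁ → M ⊗ ker ε` is onto with kernel the image of `M ⊗ R₂`; restricted
  -- to cycles it identifies the homology with the desired kernel.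
  let φ : LinearMap.ker (C.sc' 2 1 0).g.hom →ₗ[A]
      LinearMap.ker ((LinearMap.ker ε).subtype.lTensor M) :=
    (d.lTensor M ∘ₗ (LinearMap.ker (d₁.lTensor M)).subtype).codRestrict _ fun x =>
      (LinearMap.congr_fun hd₁ x.1).symm.trans x.2
  have hφ : Function.Surjective φ := by
    rintro ⟨y, hy⟩
    obtain ⟨x, rfl⟩ := LinearMap.lTensor_surjective M hd y
    refine ⟨⟨x, ?_⟩, rfl⟩
    rw [hker, hd₁]
    exact hy
  have hkerφ : LinearMap.range (C.sc' 2 1 0).moduleCatToCycles = LinearMap.ker φ := by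
    ext ⟨x, hx⟩
    have h1 := lTensor_exact M exd hd x
    rw [LinearMap.mem_ker, ← Subtype.coe_inj]
    refine Iff.trans ?_ h1.symm
    refine exists_congr fun z => ?_
    rw [← Subtype.coe_inj]
    rfl
  rw [e.toLinearEquiv.length_eq]
  exact ((Submodule.quotEquivOfEq _ _ hkerφ).trans (φ.quotKerEquivOfSurjective hφ)).length_eq

end Tor

lemma LinearMap.length_eq_ker_add_range {A X Y : Type*} [CommRing A] [AddCommGroup X] [Module A X]
    [AddCommGroup Y] [Module A Y] (g : X →ₗ[A] Y) : Module.length A X =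
      Module.length A (LinearMap.ker g) + Module.length A (LinearMap.range g) := by
  refine Module.length_eq_add_of_exact (LinearMap.ker g).subtype g.rangeRestrict
    (Submodule.subtype_injective _) g.surjective_rangeRestrict ?_
  rw [LinearMap.exact_iff, LinearMap.ker_rangeRestrict, Submodule.range_subtype]

/-! ### Functoriality and half-exactness of the kernel -/

section KernelFunctor

variable {A : Type*} [CommRing A] {K P : Type*} [AddCommGroup K] [Module A K] [AddCommGroup P]
  [Module A P] (j : K →ₗ[A] P) {M M' M'' : Type*} [AddCommGroup M] [Module A M] [AddCommGroup M']
  [Module A M'] [AddCommGroup M''] [Module A M'']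

/-- The kernel of `M ⊗ K → M ⊗ P`, as a functor in `M`. -/
def kerLTensorMap (f : M →ₗ[A] M') :
    LinearMap.ker (j.lTensor M) →ₗ[A] LinearMap.ker (j.lTensor M') :=
  (f.rTensor K ∘ₗ (LinearMap.ker (j.lTensor M)).subtype).codRestrict _ fun x => by
    have h : j.lTensor M' ∘ₗ f.rTensor K = f.rTensor P ∘ₗ j.lTensor M := by
      rw [LinearMap.lTensor_comp_rTensor, LinearMap.rTensor_comp_lTensor]
    have h1 := LinearMap.congr_fun h x.1
    rw [LinearMap.comp_apply, LinearMap.comp_apply, LinearMap.mem_ker.1 x.2, map_zero] at h1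
    exact h1

lemma coe_kerLTensorMap (f : M →ₗ[A] M') (x : LinearMap.ker (j.lTensor M)) :
    (kerLTensorMap j f x : TensorProduct A M' K) = f.rTensor K x := rfl

lemma kerLTensorMap_comp (f : M →ₗ[A] M') (g : M' →ₗ[A] M'') :
    kerLTensorMap j (g ∘ₗ f) = kerLTensorMap j g ∘ₗ kerLTensorMap j f := by
  ext x
  simp only [LinearMap.comp_apply, coe_kerLTensorMap, LinearMap.rTensor_comp]

lemma kerLTensorMap_id : kerLTensorMap j (LinearMap.id : M →ₗ[A] M) = LinearMap.id := by
  ext x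
  simp [coe_kerLTensorMap]

lemma kerLTensorMap_sub (f g : M →ₗ[A] M') :
    kerLTensorMap j (f - g) = kerLTensorMap j f - kerLTensorMap j g := by
  ext x
  simp [coe_kerLTensorMap, LinearMap.rTensor_sub]

variable [Module.Flat A P]

/-- Right exactness provides a preimage in `M' ⊗ K`; flatness of `P` makes `M' ⊗ P → M ⊗ P`
injective, so that this preimage lies in the kernel. -/
lemma kerLTensorMap_exact {f : M' →ₗ[A] M} {g : M →ₗ[A] M''} (hf : Function.Injective f)
    (h : Function.Exact f g) (hg : Function.Surjective g) :
    Function.Exact (kerLTensorMap j f) (kerLTensorMap j g) := by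
  intro x
  rw [← Subtype.coe_inj, coe_kerLTensorMap]
  refine (rTensor_exact K h hg x.1).trans ⟨?_, ?_⟩
  · rintro ⟨y, hy⟩
    refine ⟨⟨y, ?_⟩, Subtype.ext hy⟩
    apply Module.Flat.rTensor_preserves_injective_linearMap (M := P) f hf
    have h1 := LinearMap.congr_fun (show j.lTensor M ∘ₗ f.rTensor K = f.rTensor P ∘ₗ j.lTensor M' by
      rw [LinearMap.lTensor_comp_rTensor, LinearMap.rTensor_comp_lTensor]) y
    rw [LinearMap.comp_apply, LinearMap.comp_apply, hy, LinearMap.mem_ker.1 x.2] at h1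
    rw [map_zero, ← h1]
  · rintro ⟨y, hy⟩
    exact ⟨y.1, congrArg Subtype.val hy⟩

lemma length_ker_lTensor_le_add {f : M' →ₗ[A] M} {g : M →ₗ[A] M''} (hf : Function.Injective f)
    (h : Function.Exact f g) (hg : Function.Surjective g) :
    Module.length A (LinearMap.ker (j.lTensor M)) ≤
      Module.length A (LinearMap.ker (j.lTensor M')) +
        Module.length A (LinearMap.ker (j.lTensor M'')) := by
  have hex := kerLTensorMap_exact j hf h hg
  rw [(kerLTensorMap j g).length_eq_ker_add_range]
  refine add_le_add ?_ (Module.length_le_of_injective (LinearMap.range (kerLTensorMap j g)).subtype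
    (Submodule.subtype_injective _))
  rw [hex.linearMap_ker_eq]
  exact Module.length_le_of_surjective (kerLTensorMap j f).rangeRestrict
    (LinearMap.surjective_rangeRestrict _)

lemma length_ker_lTensor_prod : Module.length A (LinearMap.ker (j.lTensor (M × M'))) =
    Module.length A (LinearMap.ker (j.lTensor M)) +
      Module.length A (LinearMap.ker (j.lTensor M')) := by
  refine Module.length_eq_add_of_exact (kerLTensorMap j (LinearMap.inl A M M'))
    (kerLTensorMap j (LinearMap.snd A M M')) ?_ ?_
    (kerLTensorMap_exact j LinearMap.inl_injective .inl_snd LinearMap.snd_surjective)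
  · refine Function.LeftInverse.injective (g := kerLTensorMap j (LinearMap.fst A M M')) fun x => ?_
    rw [← LinearMap.comp_apply, ← kerLTensorMap_comp, LinearMap.fst_comp_inl, kerLTensorMap_id,
      LinearMap.id_apply]
  · refine Function.RightInverse.surjective (g := kerLTensorMap j (LinearMap.inr A M M')) fun x => ?_
    rw [← LinearMap.comp_apply, ← kerLTensorMap_comp, LinearMap.snd_comp_inr, kerLTensorMap_id,
      LinearMap.id_apply]

lemma kerLTensorMap_eq_zero_of_factorsThroughFree {A : Type u} [CommRing A] {K P : Type*}
    [AddCommGroup K] [Module A K] [AddCommGroup P] [Module A P] {j : K →ₗ[A] P}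
    (hj : Function.Injective j) {M M' : Type u}
    [AddCommGroup M] [Module A M] [AddCommGroup M'] [Module A M'] {f : M →ₗ[A] M'}
    (hf : FactorsThroughFree f) : kerLTensorMap j f = 0 := by
  obtain ⟨n, a, b, rfl⟩ := hf
  rw [kerLTensorMap_comp]
  have h : Function.Injective (j.lTensor (Fin n → A)) :=
    Module.Flat.lTensor_preserves_injective_linearMap j hj
  have : Subsingleton (LinearMap.ker (j.lTensor (Fin n → A))) := by
    rw [LinearMap.ker_eq_bot.2 h]
    infer_instance
  ext x
  rw [LinearMap.comp_apply, Subsingleton.elim (kerLTensorMap j a x) 0, map_zero,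
    LinearMap.zero_apply]

end KernelFunctor

/-! ### Properties of the Tor lengths -/

section TorLength

variable {A : Type u} [CommRing A] [IsLocalRing A]

lemma exists_torLength_eq (A : Type u) [CommRing A] [IsLocalRing A] (n : ℕ) :
    ∃ (P : ModuleCat.{u} A) (_ : Module.Flat A P) (ε : P →ₗ[A] A ⧸ maximalIdeal A ^ (n + 1)),
      Function.Surjective ε ∧ ∀ M : ModuleCat.{u} A, torLength A M n =
        Module.length A (LinearMap.ker ((LinearMap.ker ε).subtype.lTensor M)) := by
  obtain ⟨P, hP, ε, hε, h⟩ :=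
    exists_length_tor_one_eq (ModuleCat.of A (A ⧸ maximalIdeal A ^ (n + 1)))
  have := (IsProjective.iff_projective (R := A) P).2 hP
  exact ⟨P, inferInstance, ε, hε, h⟩

lemma torLength_eq_relLength {M F : Type u} [AddCommGroup M] [Module A M] [AddCommGroup F]
    [Module A F] [Module.Flat A F] (π : F →ₗ[A] M) (hπ : Function.Surjective π) (n : ℕ) :
    torLength A (ModuleCat.of A M) n = relLength (maximalIdeal A ^ (n + 1) • LinearMap.ker π)
      (LinearMap.ker π ⊓ maximalIdeal A ^ (n + 1) • ⊤) := by
  obtain ⟨P, _, ε, hε, h⟩ := exists_torLength_eq A n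
  rw [h, ← length_ker_rTensor_quotient]
  exact length_ker_lTensor_eq_length_ker_rTensor π hπ ε hε

lemma torLength_le_add {M M' M'' : Type u} [AddCommGroup M] [Module A M] [AddCommGroup M']
    [Module A M'] [AddCommGroup M''] [Module A M''] {f : M' →ₗ[A] M} {g : M →ₗ[A] M''}
    (hf : Function.Injective f) (hfg : Function.Exact f g) (hg : Function.Surjective g) (n : ℕ) :
    torLength A (ModuleCat.of A M) n ≤
      torLength A (ModuleCat.of A M') n + torLength A (ModuleCat.of A M'') n := by
  obtain ⟨P, _, ε, -, h⟩ := exists_torLength_eq A n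
  rw [h, h, h]
  exact length_ker_lTensor_le_add _ hf hfg hg

lemma torLength_prod (M M' : Type u) [AddCommGroup M] [Module A M] [AddCommGroup M']
    [Module A M'] (n : ℕ) : torLength A (ModuleCat.of A (M × M')) n =
      torLength A (ModuleCat.of A M) n + torLength A (ModuleCat.of A M') n := by
  obtain ⟨P, _, ε, -, h⟩ := exists_torLength_eq A n
  rw [h, h, h]
  exact length_ker_lTensor_prod _

/-- The functor kills `g ∘ f - id`, so `f` induces a split injection. This makes the length a stable
invariant. -/
lemma torLength_le_of_factorsThroughFree {M N : Type u} [AddCommGroup M] [Module A M]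
    [AddCommGroup N] [Module A N] (f : M →ₗ[A] N) (g : N →ₗ[A] M)
    (h : FactorsThroughFree (g ∘ₗ f - LinearMap.id)) (n : ℕ) :
    torLength A (ModuleCat.of A M) n ≤ torLength A (ModuleCat.of A N) n := by
  obtain ⟨P, _, ε, -, hP⟩ := exists_torLength_eq A n
  rw [hP, hP]
  refine Module.length_le_of_injective (kerLTensorMap _ f)
    (Function.LeftInverse.injective (g := kerLTensorMap _ g) fun x => ?_)
  have h1 := kerLTensorMap_eq_zero_of_factorsThroughFree (LinearMap.ker ε).subtype_injective h
  rw [kerLTensorMap_sub, kerLTensorMap_id, kerLTensorMap_comp] at h1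
  exact sub_eq_zero.1 (LinearMap.congr_fun h1 x)

lemma torLength_eq_zero_of_flat (M : Type u) [AddCommGroup M] [Module A M] [Module.Flat A M]
    (n : ℕ) : torLength A (ModuleCat.of A M) n = 0 := by
  rw [torLength_eq_relLength LinearMap.id Function.surjective_id, relLength_eq_zero_iff,
    LinearMap.ker_id]
  exact inf_le_left.trans bot_le

variable [IsNoetherianRing A] (M : Type u) [AddCommGroup M] [Module A M] [Module.Finite A M]

lemma torLength_ne_top (n : ℕ) : torLength A (ModuleCat.of A M) n ≠ ⊤ := by
  obtain ⟨m, π, hπ⟩ := Module.Finite.exists_fin' A M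
  rw [torLength_eq_relLength π hπ]
  exact relLength_pow_smul_inf_ne_top _ _

lemma eventuallyPoly_torLength {rs : List A} (hrs : ∀ r ∈ rs, r ∈ maximalIdeal A) {k : ℕ}
    (hk : maximalIdeal A ^ k ≤ Ideal.ofList rs) :
    EventuallyPoly rs.length (fun n => ((torLength A (ModuleCat.of A M) n).toNat : ℤ)) := by
  obtain ⟨m, π, hπ⟩ := Module.Finite.exists_fin' A M
  have h := (EventuallyPoly.relLength_inf (LinearMap.ker π)
    (eventuallyPoly_hilbertSamuel_of_pow_smul_le hrs (Submodule.smul_mono_left hk))).shift 1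
  simpa only [torLength_eq_relLength π hπ] using h

omit [IsNoetherianRing A] in
/-- Every finitely generated module over a local ring has a minimal presentation. -/
lemma exists_surjective_ker_le_smul_top : ∃ (n : ℕ) (π : (Fin n → A) →ₗ[A] M),
    Function.Surjective π ∧ LinearMap.ker π ≤ maximalIdeal A • ⊤ := by
  classical
  have hex : ∃ n : ℕ, ∃ π : (Fin n → A) →ₗ[A] M, Function.Surjective π :=
    Module.Finite.exists_fin' A M
  obtain ⟨n, ⟨π, hπ⟩, hmin⟩ : ∃ n, (∃ π : (Fin n → A) →ₗ[A] M, Function.Surjective π) ∧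
      ∀ m < n, ¬ ∃ π : (Fin m → A) →ₗ[A] M, Function.Surjective π :=
    ⟨Nat.find hex, Nat.find_spec hex, fun m hm => Nat.find_min hex hm⟩
  refine ⟨n, π, hπ, fun x hx => ?_⟩
  have hcoord : ∀ i, x i ∈ maximalIdeal A := by
    intro i
    rw [mem_maximalIdeal, mem_nonunits_iff]
    rintro ⟨v, hv⟩
    obtain ⟨m, hm⟩ : ∃ m, n = m + 1 := ⟨n - 1, by have := i.2; omega⟩
    subst hm
    -- A kernel element with a unit in coordinate `i` expresses the `i`-th generator through the
    -- others, so that generator can be dropped.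
    refine hmin m (by omega) ⟨π ∘ₗ Function.ExtendByZero.linearMap A i.succAbove, fun y => ?_⟩
    obtain ⟨z, rfl⟩ := hπ y
    refine ⟨fun l => (z - (z i * ↑v⁻¹) • x) (i.succAbove l), ?_⟩
    have hz : Function.ExtendByZero.linearMap A i.succAbove
        (fun l => (z - (z i * ↑v⁻¹) • x) (i.succAbove l)) = z - (z i * ↑v⁻¹) • x := by
      ext l
      rw [Function.ExtendByZero.linearMap_apply]
      rcases Fin.eq_self_or_eq_succAbove i l with rfl | ⟨l, rfl⟩
      · rw [Function.extend_apply' _ _ _ (by simp [Fin.succAbove_ne])]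
        simp [← hv]
      · rw [Fin.succAbove_right_injective.extend_apply]
    rw [LinearMap.comp_apply, hz, map_sub, map_smul, LinearMap.mem_ker.1 hx, smul_zero, sub_zero]
  rw [pi_eq_sum_univ' x]
  exact Submodule.sum_mem _ fun i _ => Submodule.smul_mem_smul (hcoord i) trivial

/-- If the length of `Tor₁(M, A/𝔪ⁿ⁺¹)` grows slower than `n ^ (d - 1)`, where `d` is the depth of
the syzygies of `M`, then `M` is free. -/
lemma free_of_eventuallyPoly_torLength {d r : ℕ} (hr : r < d)
    (h : EventuallyPoly r (fun n => ((torLength A (ModuleCat.of A M) n).toNat : ℤ)))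
    (hreg : ∀ (n : ℕ) (π : (Fin n → A) →ₗ[A] M), Function.Surjective π → ∃ rs : List A,
      (∀ r ∈ rs, r ∈ maximalIdeal A) ∧
        RingTheory.Sequence.IsWeaklyRegular (LinearMap.ker π) rs ∧ rs.length = d) :
    Module.Free A M := by
  obtain ⟨n, π, hπ, hker⟩ := exists_surjective_ker_le_smul_top (A := A) M
  obtain ⟨rs, hrs, hrs', rfl⟩ := hreg n π hπ
  simp only [torLength_eq_relLength π hπ] at h
  have h' := EventuallyPoly.hilbertSamuel_of_relLength_inf (LinearMap.ker π) hker
    (EventuallyPoly.of_shift 1 h)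
  rcases subsingleton_or_nontrivial (LinearMap.ker π) with hs | hs
  · have hinj : Function.Injective π := by
      rw [← LinearMap.ker_eq_bot]
      exact Submodule.eq_bot_of_subsingleton
    exact Module.Free.of_equiv (LinearEquiv.ofBijective π ⟨hinj, hπ⟩)
  · have := h'.length_lt_of_isWeaklyRegular hrs hrs'
    omega

end TorLength

open Abelian RingTheory.Sequence

/-! ### Vanishing of Ext along short exact and regular sequences -/

section ExtVanishes

variable (A : Type u) [CommRing A]

/-- `Ext^i(M, N) = 0`. -/
abbrev ExtVanishes (M N : Type u) [AddCommGroup M] [Module A M] [AddCommGroup N] [Module A N]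
    (i : ℕ) : Prop := Subsingleton (Ext (ModuleCat.of A M) (ModuleCat.of A N) i)

namespace ExtVanishes

variable {A} {X Y Z N : Type u} [AddCommGroup X] [Module A X] [AddCommGroup Y] [Module A Y]
  [AddCommGroup Z] [Module A Z] [AddCommGroup N] [Module A N] {i : ℕ}

lemma of_subsingleton_left [Subsingleton X] : ExtVanishes A X N i := by
  refine ⟨fun a b => ?_⟩
  have h : 𝟙 (ModuleCat.of A X) = 0 := by
    ext x
    exact Subsingleton.elim _ _
  rw [← Ext.mk₀_id_comp a, ← Ext.mk₀_id_comp b, h, Ext.mk₀_zero, Ext.zero_comp, Ext.zero_comp]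

lemma of_subsingleton_right [Subsingleton N] : ExtVanishes A X N i := by
  refine ⟨fun a b => ?_⟩
  have h : 𝟙 (ModuleCat.of A N) = 0 := by
    ext x
    exact Subsingleton.elim _ _
  rw [← Ext.comp_mk₀_id a, ← Ext.comp_mk₀_id b, h, Ext.mk₀_zero, Ext.comp_zero, Ext.comp_zero]

lemma congr_left (e : X ≃ₗ[A] Y) (h : ExtVanishes A Y N i) : ExtVanishes A X N i := by
  have key : ∀ a : Ext (ModuleCat.of A X) (ModuleCat.of A N) i,
      (Ext.mk₀ e.toModuleIso.hom).comp ((Ext.mk₀ e.toModuleIso.inv).comp a (zero_add i))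
        (zero_add i) = a := fun a => by
    rw [Ext.mk₀_comp_mk₀_assoc, e.toModuleIso.hom_inv_id, Ext.mk₀_id_comp]
  refine subsingleton_of_forall_eq 0 fun a => ?_
  rw [← key a, h.elim ((Ext.mk₀ e.toModuleIso.inv).comp a (zero_add i)) 0, Ext.comp_zero]

lemma zero_iff : ExtVanishes A X Y 0 ↔ Subsingleton (X →ₗ[A] Y) :=
  (Ext.addEquiv₀.toEquiv.trans ModuleCat.homEquiv).subsingleton_congr

lemma of_projective [Module.Projective A X] (hi : 1 ≤ i) : ExtVanishes A X N i := by
  obtain ⟨j, rfl⟩ : ∃ j, i = j + 1 := ⟨i - 1, by omega⟩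
  have : Projective (ModuleCat.of A X) := (IsProjective.iff_projective (R := A) X).1 inferInstance
  exact Ext.subsingleton_of_projective _ _ _

section Exact

variable {f : X →ₗ[A] Y} {g : Y →ₗ[A] Z} (hf : Function.Injective f) (hfg : Function.Exact f g)
  (hg : Function.Surjective g)

include hf hfg hg

lemma shortExact : (ModuleCat.shortComplexOfCompEqZero f g hfg.linearMap_comp_eq_zero).ShortExact :=
  ModuleCat.shortComplex_shortExact _ hfg hf hg

lemma middle_right (h1 : ExtVanishes A N X i) (h3 : ExtVanishes A N Z i) :
    ExtVanishes A N Y i := by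
  refine subsingleton_of_forall_eq 0 fun x => ?_
  obtain ⟨y, rfl⟩ := Ext.covariant_sequence_exact₂ _ (shortExact hf hfg hg) x (h3.elim _ _)
  rw [h1.elim y 0, Ext.zero_comp]

lemma quotient_right (h2 : ExtVanishes A N Y i) (h1 : ExtVanishes A N X (i + 1)) :
    ExtVanishes A N Z i := by
  refine subsingleton_of_forall_eq 0 fun x => ?_
  obtain ⟨y, rfl⟩ := Ext.covariant_sequence_exact₃ _ (shortExact hf hfg hg) x rfl (h1.elim _ _)
  rw [h2.elim y 0, Ext.zero_comp]

lemma sub_right (h3 : ExtVanishes A N Z i) (h2 : ExtVanishes A N Y (i + 1)) :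
    ExtVanishes A N X (i + 1) := by
  refine subsingleton_of_forall_eq 0 fun x => ?_
  obtain ⟨y, rfl⟩ := Ext.covariant_sequence_exact₁ _ (shortExact hf hfg hg) x (h2.elim _ _) rfl
  rw [h3.elim y 0, Ext.zero_comp]

lemma middle_left (h1 : ExtVanishes A X N i) (h3 : ExtVanishes A Z N i) :
    ExtVanishes A Y N i := by
  refine subsingleton_of_forall_eq 0 fun x => ?_
  obtain ⟨y, rfl⟩ := Ext.contravariant_sequence_exact₂ (shortExact hf hfg hg) _ x (h1.elim _ _)
  rw [h3.elim y 0, Ext.comp_zero]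

lemma sub_left (h2 : ExtVanishes A Y N i) (h3 : ExtVanishes A Z N (i + 1)) :
    ExtVanishes A X N i := by
  refine subsingleton_of_forall_eq 0 fun x => ?_
  obtain ⟨y, rfl⟩ := Ext.contravariant_sequence_exact₁ (shortExact hf hfg hg) _ x
    (add_comm 1 i) (h3.elim _ _)
  rw [h2.elim y 0, Ext.comp_zero]

lemma quotient_left (h1 : ExtVanishes A X N i) (h2 : ExtVanishes A Y N (i + 1)) :
    ExtVanishes A Z N (i + 1) := by
  refine subsingleton_of_forall_eq 0 fun x => ?_
  obtain ⟨y, rfl⟩ := Ext.contravariant_sequence_exact₃ (shortExact hf hfg hg) _ x (h2.elim _ _)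
    (add_comm 1 i)
  rw [h1.elim y 0, Ext.comp_zero]

end Exact

lemma sub_right_zero {f : X →ₗ[A] Y} (hf : Function.Injective f) (h : ExtVanishes A N Y 0) :
    ExtVanishes A N X 0 := by
  rw [zero_iff] at h ⊢
  refine ⟨fun a b => ?_⟩
  have := h.elim (f ∘ₗ a) (f ∘ₗ b)
  ext x
  exact hf (LinearMap.congr_fun this x)

lemma quotient_left_zero {g : Y →ₗ[A] Z} (hg : Function.Surjective g) (h : ExtVanishes A Y N 0) :
    ExtVanishes A Z N 0 := by
  rw [zero_iff] at h ⊢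
  refine ⟨fun a b => ?_⟩
  have := h.elim (a ∘ₗ g) (b ∘ₗ g)
  ext x
  obtain ⟨y, rfl⟩ := hg x
  exact LinearMap.congr_fun this y

open Pointwise in
lemma quotSMulTop_left {x : A} (hx : IsSMulRegular X x) (h1 : ExtVanishes A X N i)
    (h2 : ExtVanishes A X N (i + 1)) : ExtVanishes A (QuotSMulTop x X) N (i + 1) :=
  quotient_left (f := LinearMap.lsmul A X x) (g := (x • (⊤ : Submodule A X)).mkQ) hx
    (LinearMap.exact_lsmul_mkQ_smul_top X x) (Submodule.mkQ_surjective _) h1 h2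

open Pointwise in
lemma quotSMulTop_right {x : A} (hx : IsSMulRegular X x) (h1 : ExtVanishes A N X i)
    (h2 : ExtVanishes A N X (i + 1)) : ExtVanishes A N (QuotSMulTop x X) i :=
  quotient_right (f := LinearMap.lsmul A X x) (g := (x • (⊤ : Submodule A X)).mkQ) hx
    (LinearMap.exact_lsmul_mkQ_smul_top X x) (Submodule.mkQ_surjective _) h1 h2

/-- If `Ext^i(M, N) = 0` for `i ≥ c`, then `Ext^i(M / (rs) M, N) = 0` for `i ≥ c + |rs|`. -/
lemma quotient_ofList_left {rs : List A} (h : IsWeaklyRegular X rs) {c : ℕ}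
    (hc : ∀ i, c ≤ i → ExtVanishes A X N i) :
    ∀ i, c + rs.length ≤ i → ExtVanishes A (X ⧸ Ideal.ofList rs • (⊤ : Submodule A X)) N i := by
  induction rs generalizing X c with
  | nil =>
    intro i hi
    refine congr_left (Submodule.quotEquivOfEqBot _ ?_) (hc i hi)
    rw [Ideal.ofList_nil, Submodule.bot_smul]
  | cons x rs ih =>
    rw [isWeaklyRegular_cons_iff] at h
    intro i hi
    refine congr_left (Submodule.quotOfListConsSMulTopEquivQuotSMulTopInner X x rs)
      (ih h.2 (c := c + 1) (fun j hj => ?_) i (by simp only [List.length_cons] at hi; omega))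
    obtain ⟨j, rfl⟩ : ∃ l, j = l + 1 := ⟨j - 1, by omega⟩
    exact quotSMulTop_left h.1 (hc j (by omega)) (hc (j + 1) (by omega))

lemma quotient_ofList_left_of_forall {rs : List A} (h : IsWeaklyRegular X rs)
    (hc : ∀ i, ExtVanishes A X N i) :
    ∀ i, ExtVanishes A (X ⧸ Ideal.ofList rs • (⊤ : Submodule A X)) N i := by
  induction rs generalizing X with
  | nil =>
    intro i
    refine congr_left (Submodule.quotEquivOfEqBot _ ?_) (hc i)
    rw [Ideal.ofList_nil, Submodule.bot_smul]
  | cons x rs ih =>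
    rw [isWeaklyRegular_cons_iff] at h
    intro i
    refine congr_left (Submodule.quotOfListConsSMulTopEquivQuotSMulTopInner X x rs)
      (ih h.2 (fun j => ?_) i)
    cases j with
    | zero => exact quotient_left_zero (Submodule.mkQ_surjective _) (hc 0)
    | succ j => exact quotSMulTop_left h.1 (hc j) (hc (j + 1))

variable [IsLocalRing A] [IsNoetherianRing A] [Module.Finite A X] [Module.Finite A N]

open Pointwise in
/-- Nakayama's lemma for `Ext`. -/
lemma of_quotSMulTop_left {x : A} (hx : IsSMulRegular X x) (hm : x ∈ maximalIdeal A)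
    (h : ExtVanishes A (QuotSMulTop x X) N (i + 1)) : ExtVanishes A X N i := by
  by_contra ntr
  rw [not_subsingleton_iff_nontrivial] at ntr
  have : x ∈ (Module.annihilator A
      (Ext (ModuleCat.of A X) (ModuleCat.of A N) i)).jacobson :=
    (IsLocalRing.maximalIdeal_le_jacobson _) hm
  refine Submodule.top_ne_pointwise_smul_of_mem_jacobson_annihilator this ?_
  refine (eq_top_iff.2 fun y _ => ?_).symm
  have hS := shortExact (f := LinearMap.lsmul A X x) (g := (x • (⊤ : Submodule A X)).mkQ) hx
    (LinearMap.exact_lsmul_mkQ_smul_top X x) (Submodule.mkQ_surjective _)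
  -- Vanishing of the next Ext of `X/xX` makes multiplication by `x` surjective on `Extⁱ(X, N)`.
  obtain ⟨z, rfl⟩ := Ext.contravariant_sequence_exact₁ hS _ y (add_comm 1 i) (h.elim _ _)
  have hz : (Ext.mk₀ (ModuleCat.ofHom (LinearMap.lsmul A X x))).comp z (zero_add i) = x • z := by
    rw [show ModuleCat.ofHom (LinearMap.lsmul A X x) = x • 𝟙 (ModuleCat.of A X) from rfl,
      Ext.mk₀_smul, Ext.smul_comp, Ext.mk₀_id_comp]
  change (Ext.mk₀ (ModuleCat.ofHom (LinearMap.lsmul A X x))).comp z (zero_add i) ∈ _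
  rw [hz]
  exact Submodule.smul_mem_pointwise_smul _ _ _ trivial

/-- By Nakayama, vanishing for `X/xX` in degree `i + 1` gives vanishing for `X` in degree `i`. Each
regular element lowers the bound `t` by one. -/
lemma of_isWeaklyRegular {rs : List A} (h : IsWeaklyRegular X rs)
    (hm : ∀ r ∈ rs, r ∈ maximalIdeal A) {t : ℕ}
    (ht : ∀ i, t ≤ i → ∀ (M : Type u) [AddCommGroup M] [Module A M] [Module.Finite A M],
      ExtVanishes A M N i) (hi : t ≤ i + rs.length) : ExtVanishes A X N i := by
  induction rs generalizing X i with
  | nil => exact ht i hi X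
  | cons x rs ih =>
    rw [isWeaklyRegular_cons_iff] at h
    exact of_quotSMulTop_left h.1 (hm x List.mem_cons_self)
      (ih h.2 (fun r hr => hm r (List.mem_cons_of_mem _ hr))
        (by simp only [List.length_cons] at hi; omega))

end ExtVanishes

end ExtVanishes

/-! ### Depth through Ext from the residue field -/

section Depth

variable {A : Type u} [CommRing A] [IsLocalRing A] [IsNoetherianRing A]
  {M : Type u} [AddCommGroup M] [Module A M] [Module.Finite A M]

omit [IsNoetherianRing A] in
lemma support_quotient_maximalIdeal : Module.support A (A ⧸ maximalIdeal A) =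
    PrimeSpectrum.zeroLocus (maximalIdeal A) := by
  rw [Module.support_eq_zeroLocus, Ideal.annihilator_quotient]

omit [IsNoetherianRing A] in
lemma maximalIdeal_smul_top_lt [Nontrivial M] :
    maximalIdeal A • (⊤ : Submodule A M) < ⊤ :=
  (Submodule.top_ne_ideal_smul_of_le_jacobson_annihilator
    (IsLocalRing.maximalIdeal_le_jacobson _)).symm.lt_top

lemma exists_isWeaklyRegular_of_extVanishes {n : ℕ}
    (h : ∀ i < n, ExtVanishes A (A ⧸ maximalIdeal A) M i) :
    ∃ rs : List A, rs.length = n ∧ (∀ r ∈ rs, r ∈ maximalIdeal A) ∧ IsWeaklyRegular M rs := by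
  rcases subsingleton_or_nontrivial M with hM | hM
  · refine ⟨List.replicate n 0, List.length_replicate, fun r hr => ?_, ⟨fun i hi => ?_⟩⟩
    · rw [(List.mem_replicate.1 hr).2]
      exact zero_mem _
    · exact fun a b _ => Subsingleton.elim a b
  · obtain ⟨rs, h1, h2, h3⟩ := ModuleCat.exists_isRegular_of_exists_subsingleton_ext
      (maximalIdeal A) n (ModuleCat.of A M) maximalIdeal_smul_top_lt
      (ModuleCat.of A (A ⧸ maximalIdeal A)) support_quotient_maximalIdeal h
    exact ⟨rs, h1, h2, h3.1⟩

lemma ExtVanishes.of_isWeaklyRegular_right {I : Ideal A} (hI : I ≤ maximalIdeal A) {N : Type u}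
    [AddCommGroup N] [Module A N] [Module.Finite A N] (hN : I ≤ Module.annihilator A N)
    {rs : List A} (hm : ∀ r ∈ rs, r ∈ I) (h : IsWeaklyRegular M rs) {i : ℕ}
    (hi : i < rs.length) : ExtVanishes A N M i := by
  rcases subsingleton_or_nontrivial M with hM | hM
  · exact of_subsingleton_right
  · refine ModuleCat.subsingleton_ext_of_exists_isRegular I (ModuleCat.of A N) ?_
      (ModuleCat.of A M) ?_ rs hm (IsRegular.of_isWeaklyRegular_of_mem_maximalIdeal M
        (fun r hr => hI (hm r hr)) h) i hi
    · rw [Module.support_eq_zeroLocus]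
      exact PrimeSpectrum.zeroLocus_anti_mono hN
    · exact (Submodule.smul_mono_left hI).trans_lt maximalIdeal_smul_top_lt

lemma ExtVanishes.of_isWeaklyRegular_maximalIdeal {rs : List A}
    (hm : ∀ r ∈ rs, r ∈ maximalIdeal A) (h : IsWeaklyRegular M rs) {i : ℕ}
    (hi : i < rs.length) : ExtVanishes A (A ⧸ maximalIdeal A) M i :=
  of_isWeaklyRegular_right le_rfl (by rw [Ideal.annihilator_quotient]) hm h hi

/-- If `Hom(A/𝔪, M)` vanished, `𝔪` would contain an `M`-regular element; and a nonzero map out of a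
simple module is injective. -/
lemma exists_injective_of_forall_not_isSMulRegular
    (h : ∀ x ∈ maximalIdeal A, ¬ IsSMulRegular M x) :
    ∃ f : (A ⧸ maximalIdeal A) →ₗ[A] M, Function.Injective f := by
  by_contra! hc
  have : IsSimpleModule A (A ⧸ maximalIdeal A) :=
    isSimpleModule_iff_quot_maximal.2 ⟨_, inferInstance, ⟨LinearEquiv.refl _ _⟩⟩
  have hs : Subsingleton ((A ⧸ maximalIdeal A) →ₗ[A] M) :=
    subsingleton_of_forall_eq 0 fun f =>
      (LinearMap.injective_or_eq_zero f).resolve_left (hc f)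
  obtain ⟨x, hx, hreg⟩ := IsSMulRegular.subsingleton_linearMap_iff.1 hs
  rw [Ideal.annihilator_quotient] at hx
  exact h x hx hreg

end Depth

/-! ### Cohomological criterion for maximal Cohen-Macaulay modules -/

section MCM

variable {A : Type u} [CommRing A] [IsLocalRing A] [IsNoetherianRing A]

/-- Replaces a regular sequence, which depends on the module, by Ext vanishing, which long exact
sequences transport. -/
lemma isMCM_iff {d : ℕ} (hd : ringKrullDim A = d) {M : Type u} [AddCommGroup M] [Module A M]
    [Module.Finite A M] :
    IsMCM A M ↔ ∀ i < d, ExtVanishes A (A ⧸ maximalIdeal A) M i := by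
  constructor
  · rintro ⟨-, rs, hm, hreg, hlen⟩ i hi
    rw [hd] at hlen
    have hlen' : rs.length = d := by exact_mod_cast hlen
    exact ExtVanishes.of_isWeaklyRegular_maximalIdeal hm hreg (hlen'.symm ▸ hi)
  · intro h
    obtain ⟨rs, hlen, hm, hreg⟩ := exists_isWeaklyRegular_of_extVanishes h
    exact ⟨inferInstance, rs, hm, hreg, by rw [hlen, hd]⟩

omit [IsNoetherianRing A] in
lemma IsMCM.exists_regular_length {d : ℕ} (hd : ringKrullDim A = d) {M : Type u} [AddCommGroup M]
    [Module A M] (h : IsMCM A M) : ∃ rs : List A, (∀ r ∈ rs, r ∈ maximalIdeal A) ∧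
      IsWeaklyRegular M rs ∧ rs.length = d := by
  obtain ⟨-, rs, hm, hreg, hlen⟩ := h
  rw [hd] at hlen
  exact ⟨rs, hm, hreg, by exact_mod_cast hlen⟩

/-- A regular sequence of length `dim A` is maximal. -/
lemma not_isSMulRegular_of_length_eq {d : ℕ} (hd : ringKrullDim A = d) {M : Type u}
    [AddCommGroup M] [Module A M] [Module.Finite A M] [Nontrivial M] {rs : List A}
    (hm : ∀ r ∈ rs, r ∈ maximalIdeal A) (hreg : IsWeaklyRegular M rs) (hlen : rs.length = d)
    (x : A) (hx : x ∈ maximalIdeal A) :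
    ¬ IsSMulRegular (M ⧸ Ideal.ofList rs • (⊤ : Submodule A M)) x := by
  intro h
  have h1 : IsWeaklyRegular M (rs ++ [x]) :=
    (isWeaklyRegular_append_iff M rs [x]).2 ⟨hreg, (isWeaklyRegular_singleton_iff _ x).2 h⟩
  have h2 := IsRegular.of_isWeaklyRegular_of_mem_maximalIdeal M (fun r hr => by
    rcases List.mem_append.1 hr with hr | hr
    · exact hm r hr
    · rwa [List.mem_singleton.1 hr]) h1
  have h3 := Module.supportDim_add_length_eq_supportDim_of_isRegular _ h2
  have h4 := Module.supportDim_le_ringKrullDim A M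
  have := h2.quot_ofList_smul_nontrivial ⊤
  have h5 : 0 ≤ Module.supportDim A (M ⧸ Ideal.ofList (rs ++ [x]) • (⊤ : Submodule A M)) := by
    obtain ⟨c, hc⟩ := WithBot.ne_bot_iff_exists.1
      (Module.supportDim_ne_bot_of_nontrivial A (M ⧸ Ideal.ofList (rs ++ [x]) • (⊤ : Submodule A M)))
    rw [← hc]
    exact WithBot.coe_le_coe.2 zero_le
  rw [← h3, hd, List.length_append, List.length_singleton, hlen] at h4
  have h6 : ((d + 1 : ℕ) : WithBot ℕ∞) ≤ d := le_trans (le_add_of_nonneg_left h5) h4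
  have : d + 1 ≤ d := by exact_mod_cast h6
  omega

end MCM

/-! ### Injective dimension, depth and dimension of a Gorenstein ring -/

section Gorenstein

variable {A : Type u} [CommRing A] [IsLocalRing A] [IsNoetherianRing A]

open Pointwise in
/-- Bass' lemma: vanishing of `Ext` on finitely generated modules can be tested on the residue
field. -/
lemma ExtVanishes.of_residueField {Y : Type u} [AddCommGroup Y] [Module A Y] [Module.Finite A Y]
    {i : ℕ} (h1 : ∀ (N : Type u) [AddCommGroup N] [Module A N] [Module.Finite A N],
      ExtVanishes A N Y (i + 1)) (hk : ExtVanishes A (A ⧸ maximalIdeal A) Y i)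
    (N : Type u) [AddCommGroup N] [Module A N] [hN : Module.Finite A N] :
    ExtVanishes A N Y i := by
  induction hN using IsNoetherianRing.induction_on_isQuotientEquivQuotientPrime A with
  | subsingleton N => exact of_subsingleton_left
  | quotient N p e =>
    by_cases hp : p.1 = maximalIdeal A
    · rw [hp] at e
      exact hk.congr_left e
    · obtain ⟨y, hy, hyp⟩ := Set.not_subset.1 fun hle : (maximalIdeal A : Set A) ⊆ p.1 =>
        hp (le_antisymm (le_maximalIdeal p.2.ne_top) hle)
      have hreg : IsSMulRegular N y := by
        refine isSMulRegular_iff_right_eq_zero_of_smul.2 fun n hn => ?_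
        obtain ⟨a, ha⟩ := Ideal.Quotient.mk_surjective (e n)
        have h2 : y • e n = 0 := by rw [← map_smul, hn, map_zero]
        rw [← ha] at h2
        have h3 : y * a ∈ p.1 := Ideal.Quotient.eq_zero_iff_mem.1 h2
        have h4 : e n = 0 := by
          rw [← ha]
          exact Ideal.Quotient.eq_zero_iff_mem.2 ((p.2.mem_or_mem h3).resolve_left hyp)
        simpa using h4
      exact of_quotSMulTop_left hreg hy (h1 _)
  | exact N₁ N₂ N₃ f g hf hg hfg h₁ h₃ => exact middle_left hf hfg hg h₁ h₃

/-- The injective dimension `s` of a Gorenstein ring. -/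
lemma IsGorensteinLocalRing.exists_injectiveDimension (hA : IsGorensteinLocalRing A) :
    ∃ s : ℕ, (∀ i, s + 1 ≤ i → ∀ (N : Type u) [AddCommGroup N] [Module A N] [Module.Finite A N],
      ExtVanishes A N A i) ∧ ¬ ExtVanishes A (A ⧸ maximalIdeal A) A s := by
  classical
  have hex : ∃ t : ℕ, ∀ i, t ≤ i → ∀ (N : Type u) [AddCommGroup N] [Module A N]
      [Module.Finite A N], ExtVanishes A N A i := by
    obtain ⟨n, hn⟩ := hA.finite_injectiveDimension
    exact ⟨n, fun i hi N _ _ _ => HasInjectiveDimensionLT.subsingleton _ n i hi _⟩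
  have h1 := Nat.find_spec hex
  have h2 : Nat.find hex ≠ 0 := by
    intro h0
    rw [h0] at h1
    have h3 := (ExtVanishes.zero_iff.1 (h1 0 le_rfl A)).elim LinearMap.id 0
    exact one_ne_zero (LinearMap.congr_fun h3 1)
  obtain ⟨s, hs⟩ := Nat.exists_eq_succ_of_ne_zero h2
  refine ⟨s, fun i hi => h1 i (by omega), fun hk => ?_⟩
  refine Nat.find_min hex (show s < Nat.find hex by omega) fun i hi N _ _ _ => ?_
  rcases hi.eq_or_lt with rfl | hi
  · exact ExtVanishes.of_residueField (fun N _ _ _ => h1 _ (by omega) N) hk N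
  · exact h1 i (by omega) N

/-- Over a Gorenstein local ring of dimension `d` that has a nonzero maximal Cohen-Macaulay module,
`A` is maximal Cohen-Macaulay and has injective dimension at most `d`. -/
lemma IsGorensteinLocalRing.isMCM_and_extVanishes (hA : IsGorensteinLocalRing A) {d : ℕ}
    (hd : ringKrullDim A = d) {M : Type u} [AddCommGroup M] [Module A M] [Nontrivial M]
    (hM : IsMCM A M) : IsMCM A A ∧ ∀ i, d + 1 ≤ i → ∀ (N : Type u) [AddCommGroup N] [Module A N]
      [Module.Finite A N], ExtVanishes A N A i := by
  classical
  have := hM.finite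
  obtain ⟨s, hs, hks⟩ := hA.exists_injectiveDimension
  have hex : ∃ i, ¬ ExtVanishes A (A ⧸ maximalIdeal A) A i := ⟨s, hks⟩
  obtain ⟨s', hs', hmin⟩ : ∃ s', ¬ ExtVanishes A (A ⧸ maximalIdeal A) A s' ∧
      ∀ i < s', ExtVanishes A (A ⧸ maximalIdeal A) A i :=
    ⟨Nat.find hex, Nat.find_spec hex, fun i hi => not_not.1 (Nat.find_min hex hi)⟩
  obtain ⟨rs, hlen, hm, hreg⟩ := exists_isWeaklyRegular_of_extVanishes hmin
  -- As `Ext^(s+1)` vanishes, `Ext^s(-, A)` turns injections into surjections, so it is nonzero on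
  -- every module containing the residue field.
  have hsub : ∀ {B : Type u} [AddCommGroup B] [Module A B] [Module.Finite A B]
      (f : (A ⧸ maximalIdeal A) →ₗ[A] B), Function.Injective f → ¬ ExtVanishes A B A s := by
    intro B _ _ _ f hf hB
    exact hks (ExtVanishes.sub_left hf (f.exact_map_mkQ_range) (Submodule.mkQ_surjective _) hB
      (hs _ le_rfl _))
  -- Modulo a maximal `A`-regular sequence of length `s'`, the ring contains the residue field,
  -- while its `Extⁱ(-, A)` vanishes for `i > s'`.
  have hle : s ≤ s' := by
    by_contra! hlt
    obtain ⟨f, hf⟩ := exists_injective_of_forall_not_isSMulRegular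
      (M := A ⧸ Ideal.ofList rs • (⊤ : Submodule A A)) (fun x hx hxreg => by
        have h1 : IsWeaklyRegular A (rs ++ [x]) :=
          (isWeaklyRegular_append_iff A rs [x]).2
            ⟨hreg, (isWeaklyRegular_singleton_iff _ x).2 hxreg⟩
        refine hs' (ExtVanishes.of_isWeaklyRegular_maximalIdeal (fun r hr => ?_) h1 (by
          rw [List.length_append, List.length_singleton]; omega))
        rcases List.mem_append.1 hr with hr | hr
        · exact hm r hr
        · rwa [List.mem_singleton.1 hr])
    exact hsub f hf (ExtVanishes.quotient_ofList_left hreg (c := 1)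
      (fun i hi => ExtVanishes.of_projective hi) s (by omega))
  -- If `s < d`, the `d` regular elements on `M` push the vanishing of `Extⁱ(M, A)` down to all `i ≥
  -- 0`, and it passes to `M/(ms)M`, which contains the residue field.
  have hds : d ≤ s := by
    by_contra! hlt
    obtain ⟨ms, hmm, hmreg, hmlen⟩ := hM.exists_regular_length hd
    have h1 : ∀ i, ExtVanishes A M A i := fun i =>
      ExtVanishes.of_isWeaklyRegular hmreg hmm hs (by omega)
    obtain ⟨f, hf⟩ := exists_injective_of_forall_not_isSMulRegular
      (not_isSMulRegular_of_length_eq hd hmm hmreg hmlen)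
    exact hsub f hf (ExtVanishes.quotient_ofList_left_of_forall hmreg h1 s)
  have hsd : s' ≤ d := by
    have h1 := IsRegular.of_isWeaklyRegular_of_mem_maximalIdeal A hm hreg
    have h2 := ringKrullDim_add_length_eq_ringKrullDim_of_isRegular rs h1
    have : Nontrivial (A ⧸ Ideal.ofList rs) := by
      have := h1.quot_ofList_smul_nontrivial ⊤
      rwa [smul_eq_mul, Ideal.mul_top] at this
    have h3 : (0 : WithBot ℕ∞) ≤ ringKrullDim (A ⧸ Ideal.ofList rs) := ringKrullDim_nonneg_of_nontrivial
    rw [hd, hlen] at h2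
    have h4 : (s' : WithBot ℕ∞) ≤ d := by
      rw [← h2]
      exact le_add_of_nonneg_left h3
    exact_mod_cast h4
  exact ⟨(isMCM_iff hd).2 fun i hi => hmin i (by omega), fun i hi => hs i (by omega)⟩

/-- `Ext^i(M, A) = 0` for `i ≥ 1` and `M` maximal Cohen-Macaulay. -/
lemma IsMCM.extVanishes {d : ℕ} (hd : ringKrullDim A = d) {M : Type u} [AddCommGroup M]
    [Module A M] (hM : IsMCM A M) (h : ∀ i, d + 1 ≤ i → ∀ (N : Type u) [AddCommGroup N]
      [Module A N] [Module.Finite A N], ExtVanishes A N A i) {i : ℕ} (hi : 1 ≤ i) :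
    ExtVanishes A M A i := by
  have := hM.finite
  obtain ⟨rs, hm, hreg, hlen⟩ := hM.exists_regular_length hd
  exact ExtVanishes.of_isWeaklyRegular hreg hm h (by omega)

end Gorenstein

/-! ### Lifting and extending maps modulo a regular sequence -/

section Lifting

variable {A : Type u} [CommRing A] {X Y Z N : Type u} [AddCommGroup X] [Module A X]
  [AddCommGroup Y] [Module A Y] [AddCommGroup Z] [Module A Z] [AddCommGroup N] [Module A N]

namespace ExtVanishes

section Exact

variable {f : X →ₗ[A] Y} {g : Y →ₗ[A] Z} (hf : Function.Injective f) (hfg : Function.Exact f g)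
  (hg : Function.Surjective g)

include hf hfg hg

lemma exists_lift (h : ExtVanishes A N X 1) (φ : N →ₗ[A] Z) : ∃ ψ : N →ₗ[A] Y, g ∘ₗ ψ = φ := by
  obtain ⟨y, hy⟩ := Ext.covariant_sequence_exact₃ _ (shortExact hf hfg hg)
    (Ext.mk₀ (ModuleCat.ofHom φ)) rfl (h.elim _ _)
  obtain ⟨ψ, rfl⟩ := Ext.addEquiv₀.symm.surjective y
  refine ⟨ψ.hom, ?_⟩
  rw [Ext.addEquiv₀_symm_apply, Ext.mk₀_comp_mk₀] at hy
  exact congrArg ModuleCat.Hom.hom (Ext.addEquiv₀.symm.injective hy)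

lemma exists_extend (h : ExtVanishes A Z N 1) (φ : X →ₗ[A] N) : ∃ ψ : Y →ₗ[A] N, ψ ∘ₗ f = φ := by
  obtain ⟨y, hy⟩ := Ext.contravariant_sequence_exact₁ (shortExact hf hfg hg) _
    (Ext.mk₀ (ModuleCat.ofHom φ)) (add_comm 1 0) (h.elim _ _)
  obtain ⟨ψ, rfl⟩ := Ext.addEquiv₀.symm.surjective y
  refine ⟨ψ.hom, ?_⟩
  rw [Ext.addEquiv₀_symm_apply, Ext.mk₀_comp_mk₀] at hy
  exact congrArg ModuleCat.Hom.hom (Ext.addEquiv₀.symm.injective hy)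

end Exact

-- Lifts through one regular element at a time: the obstruction lies in an `Ext¹`, and the vanishing
-- of positive Ext passes to `X/xX`.
open Pointwise in
lemma exists_lift_mkQ_ofList {rs : List A} (hreg : IsWeaklyRegular X rs)
    (h : ∀ i, 1 ≤ i → ExtVanishes A N X i)
    (φ : N →ₗ[A] X ⧸ Ideal.ofList rs • (⊤ : Submodule A X)) :
    ∃ ψ : N →ₗ[A] X, (Ideal.ofList rs • (⊤ : Submodule A X)).mkQ ∘ₗ ψ = φ := by
  induction rs generalizing X with
  | nil =>
    have h0 : Ideal.ofList ([] : List A) • (⊤ : Submodule A X) = ⊥ := by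
      rw [Ideal.ofList_nil, Submodule.bot_smul]
    refine ⟨(Submodule.quotEquivOfEqBot _ h0).toLinearMap ∘ₗ φ, ?_⟩
    ext n
    obtain ⟨x, hx⟩ := Submodule.mkQ_surjective _ (φ n)
    simp only [LinearMap.comp_apply, ← hx]
    rfl
  | cons x rs ih =>
    rw [isWeaklyRegular_cons_iff] at hreg
    let e := Submodule.quotOfListConsSMulTopEquivQuotSMulTopInner X x rs
    obtain ⟨ψ', hψ'⟩ := ih hreg.2 (fun i hi => quotSMulTop_right hreg.1 (h i hi) (h _ (by omega)))
      (e.toLinearMap ∘ₗ φ)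
    obtain ⟨ψ, hψ⟩ := exists_lift (f := LinearMap.lsmul A X x) (g := (x • (⊤ : Submodule A X)).mkQ)
      hreg.1 (LinearMap.exact_lsmul_mkQ_smul_top X x) (Submodule.mkQ_surjective _) (h 1 le_rfl) ψ'
    refine ⟨ψ, ?_⟩
    ext n
    apply e.injective
    have h1 := LinearMap.congr_fun hψ' n
    have h2 := LinearMap.congr_fun hψ n
    simp only [LinearMap.comp_apply, LinearEquiv.coe_coe] at h1 h2 ⊢
    rw [← h1, ← h2]
    rfl

lemma smul_eq_zero_of_mem_annihilator {x : A} (hx : x ∈ Module.annihilator A N) {i : ℕ}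
    (β : Ext (ModuleCat.of A N) (ModuleCat.of A X) i) : x • β = 0 := by
  have h : x • 𝟙 (ModuleCat.of A N) = 0 := by
    ext n
    exact Module.mem_annihilator.1 hx n
  rw [← Ext.mk₀_id_comp β, ← Ext.smul_comp, ← Ext.mk₀_smul, h, Ext.mk₀_zero, Ext.zero_comp]

-- Dimension shifting between `Hom(N, X/(rs)X)` and `Ext` into `X` in degree `|rs|`, one element at
-- a time. It reduces extending a map along `ι` to surjectivity on the top Ext, without a change of
-- rings.
open Pointwise in
lemma exists_extend_mkQ_ofList [IsLocalRing A] [IsNoetherianRing A] [Module.Finite A X]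
    {N' : Type u} [AddCommGroup N'] [Module A N'] [Module.Finite A N'] {ι : N' →ₗ[A] N}
    {I : Ideal A} (hI : I ≤ maximalIdeal A) (hN' : I ≤ Module.annihilator A N')
    (hN : I ≤ Module.annihilator A N) {rs : List A} (hrs : ∀ r ∈ rs, r ∈ I)
    (hreg : IsWeaklyRegular X rs)
    (h : ∀ α : Ext (ModuleCat.of A N') (ModuleCat.of A X) rs.length,
      ∃ β : Ext (ModuleCat.of A N) (ModuleCat.of A X) rs.length,
        (Ext.mk₀ (ModuleCat.ofHom ι)).comp β (zero_add _) = α)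
    (φ : N' →ₗ[A] X ⧸ Ideal.ofList rs • (⊤ : Submodule A X)) :
    ∃ ψ : N →ₗ[A] X ⧸ Ideal.ofList rs • (⊤ : Submodule A X), ψ ∘ₗ ι = φ := by
  induction rs generalizing X with
  | nil =>
    have h0 : Ideal.ofList ([] : List A) • (⊤ : Submodule A X) = ⊥ := by
      rw [Ideal.ofList_nil, Submodule.bot_smul]
    let e := Submodule.quotEquivOfEqBot _ h0
    obtain ⟨β, hβ⟩ := h (Ext.mk₀ (ModuleCat.ofHom (e.toLinearMap ∘ₗ φ)))
    obtain ⟨ψ, rfl⟩ := Ext.addEquiv₀.symm.surjective β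
    refine ⟨e.symm.toLinearMap ∘ₗ ψ.hom, ?_⟩
    rw [Ext.addEquiv₀_symm_apply, Ext.mk₀_comp_mk₀] at hβ
    have h1 := congrArg ModuleCat.Hom.hom (Ext.addEquiv₀.symm.injective hβ)
    ext n
    apply e.injective
    simp only [LinearMap.comp_apply, LinearEquiv.coe_coe, LinearEquiv.apply_symm_apply]
    exact LinearMap.congr_fun h1 n
  | cons x rs ih =>
    have hreg' := hreg
    rw [isWeaklyRegular_cons_iff] at hreg
    let e := Submodule.quotOfListConsSMulTopEquivQuotSMulTopInner X x rs
    have hS := shortExact (f := LinearMap.lsmul A X x) (g := (x • (⊤ : Submodule A X)).mkQ) hreg.1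
      (LinearMap.exact_lsmul_mkQ_smul_top X x) (Submodule.mkQ_surjective _)
    obtain ⟨ψ, hψ⟩ := ih (fun r hr => hrs r (List.mem_cons_of_mem _ hr)) hreg.2 (fun α => by
      obtain ⟨β, hβ⟩ := h (α.comp hS.extClass rfl)
      -- Since `x` kills `N`, the class `β` comes from `Ext` into `X/xX`. Its restriction to `N'` is
      -- then the given `α`, because the Ext of `N'` into `X` one degree lower vanishes.
      have hxβ : β.comp (Ext.mk₀ (ModuleCat.ofHom (LinearMap.lsmul A X x))) (add_zero _) = 0 := by
        rw [show ModuleCat.ofHom (LinearMap.lsmul A X x) = x • 𝟙 (ModuleCat.of A X) from rfl,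
          Ext.mk₀_smul, Ext.comp_smul, Ext.comp_mk₀_id]
        exact smul_eq_zero_of_mem_annihilator (hN (hrs x List.mem_cons_self)) β
      obtain ⟨β', hβ'⟩ := Ext.covariant_sequence_exact₁ _ hS β hxβ rfl
      refine ⟨β', ?_⟩
      have h1 : ((Ext.mk₀ (ModuleCat.ofHom ι)).comp β' (zero_add _) - α).comp hS.extClass rfl
          = 0 := by
        rw [sub_eq_add_neg, Ext.add_comp, Ext.neg_comp, ← sub_eq_add_neg, sub_eq_zero, ← hβ, ← hβ']
        exact Ext.comp_assoc _ _ _ _ _ (by omega)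
      obtain ⟨γ, hγ⟩ := Ext.covariant_sequence_exact₃ _ hS _ rfl h1
      have h2 : ExtVanishes A N' X rs.length :=
        of_isWeaklyRegular_right hI hN' hrs hreg' (by simp)
      rw [← sub_eq_zero, ← hγ]
      change Ext.comp γ _ _ = 0
      rw [h2.elim γ 0, Ext.zero_comp]) (e.toLinearMap ∘ₗ φ)
    refine ⟨e.symm.toLinearMap ∘ₗ ψ, ?_⟩
    rw [LinearMap.comp_assoc, hψ]
    ext n
    simp

end ExtVanishes

end Lifting

/-! ### Functionals separate points modulo a maximal regular sequence -/

section Duality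

variable {A : Type u} [CommRing A] [IsLocalRing A] [IsNoetherianRing A] {M N : Type u}
  [AddCommGroup M] [Module A M] [AddCommGroup N] [Module A N] [Module.Finite A M]

open Pointwise in
/-- A map of finitely generated modules that is injective modulo an `N`-regular sequence is
injective, and its cokernel has the same regular sequence. -/
lemma injective_and_isWeaklyRegular_of_injective_mod {f : M →ₗ[A] N} {rs : List A}
    (hm : ∀ r ∈ rs, r ∈ maximalIdeal A) (hN : IsWeaklyRegular N rs)
    (h : ∀ m, f m ∈ Ideal.ofList rs • (⊤ : Submodule A N) →
      m ∈ Ideal.ofList rs • (⊤ : Submodule A M)) :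
    Function.Injective f ∧ IsWeaklyRegular (N ⧸ LinearMap.range f) rs := by
  induction rs generalizing M N with
  | nil =>
    refine ⟨(injective_iff_map_eq_zero f).2 fun m hfm => ?_, IsWeaklyRegular.nil _ _⟩
    have := h m (by rw [hfm]; exact zero_mem _)
    rwa [Ideal.ofList_nil, Submodule.bot_smul, Submodule.mem_bot] at this
  | cons x rs ih =>
    rw [isWeaklyRegular_cons_iff] at hN
    have hxm := hm x List.mem_cons_self
    have key : ∀ {L : Type u} [AddCommGroup L] [Module A L] (l : L),
        (Submodule.Quotient.mk l : QuotSMulTop x L) ∈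
          Ideal.ofList rs • (⊤ : Submodule A (QuotSMulTop x L)) ↔
        l ∈ Ideal.ofList (x :: rs) • (⊤ : Submodule A L) := by
      intro L _ _ l
      let e := Submodule.quotOfListConsSMulTopEquivQuotSMulTopInner L x rs
      rw [← Submodule.Quotient.mk_eq_zero, ← Submodule.Quotient.mk_eq_zero,
        ← e.map_eq_zero_iff]
      rfl
    obtain ⟨h1, h2⟩ := ih (f := QuotSMulTop.map x f)
      (fun r hr => hm r (List.mem_cons_of_mem _ hr)) hN.2 (fun m' hm' => by
        obtain ⟨m, rfl⟩ := Submodule.Quotient.mk_surjective _ m'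
        rw [QuotSMulTop.map_apply_mk] at hm'
        exact (key m).2 (h m ((key (f m)).1 hm')))
    -- Injectivity modulo `x`: with `x` regular on `N`, it gives `ker f = x · ker f`, hence zero by
    -- Nakayama, and regularity of `x` on the cokernel.
    have h3 : ∀ m, f m ∈ x • (⊤ : Submodule A N) → m ∈ x • (⊤ : Submodule A M) := by
      intro m hfm
      rw [← Submodule.Quotient.mk_eq_zero] at hfm ⊢
      apply h1
      rw [QuotSMulTop.map_apply_mk, map_zero]
      exact hfm
    constructor
    · rw [← LinearMap.ker_eq_bot]
      refine Submodule.eq_bot_of_le_smul_of_le_jacobson_bot (Ideal.span {x}) _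
        (IsNoetherian.noetherian _) (fun m hfm => ?_) ?_
      · rw [Submodule.ideal_span_singleton_smul]
        obtain ⟨m', -, rfl⟩ := h3 m (by rw [LinearMap.mem_ker.1 hfm]; exact zero_mem _)
        refine Submodule.smul_mem_pointwise_smul _ _ _ (hN.1 ?_)
        simpa using hfm
      · rw [Ideal.span_singleton_le_iff_mem]
        exact IsLocalRing.maximalIdeal_le_jacobson _ hxm
    · rw [isWeaklyRegular_cons_iff]
      constructor
      · refine isSMulRegular_iff_right_eq_zero_of_smul.2 fun y hy => ?_
        obtain ⟨n, rfl⟩ := Submodule.Quotient.mk_surjective _ y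
        rw [← Submodule.Quotient.mk_smul, Submodule.Quotient.mk_eq_zero] at hy
        obtain ⟨m, hm⟩ := hy
        obtain ⟨m', -, rfl⟩ := h3 m (by
          rw [hm]
          exact Submodule.smul_mem_pointwise_smul _ _ _ trivial)
        rw [Submodule.Quotient.mk_eq_zero]
        refine ⟨m', hN.1 ?_⟩
        simpa using hm
      · have hex := QuotSMulTop.map_exact x (LinearMap.exact_map_mkQ_range f)
          (Submodule.mkQ_surjective _)
        exact ((hex.linearEquivOfSurjective
          (QuotSMulTop.map_surjective x (Submodule.mkQ_surjective _))).isWeaklyRegular_congr rs).1 h2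

/-- The dual of `M` separates the points of `M / (rs) M`. -/
lemma exists_dual_apply_notMem_ofList {d : ℕ} (hd : ringKrullDim A = d)
    (hE : ∀ (N : Type u) [AddCommGroup N] [Module A N] [Module.Finite A N],
      ExtVanishes A N A (d + 1)) {rs : List A}
    (hm : ∀ r ∈ rs, r ∈ maximalIdeal A) (hreg : IsWeaklyRegular A rs) (hlen : rs.length = d)
    (hM : ∀ i, 1 ≤ i → ExtVanishes A M A i) {m : M}
    (hmem : m ∉ Ideal.ofList rs • (⊤ : Submodule A M)) :
    ∃ φ : M →ₗ[A] A, φ m ∉ Ideal.ofList rs := by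
  let N := M ⧸ Ideal.ofList rs • (⊤ : Submodule A M)
  let y : N := Submodule.Quotient.mk m
  have hy : y ≠ 0 := fun h => hmem ((Submodule.Quotient.mk_eq_zero _).1 h)
  have hIN : Ideal.ofList rs ≤ Module.annihilator A N := fun a ha => by
    refine Module.mem_annihilator.2 fun z => ?_
    obtain ⟨z, rfl⟩ := Submodule.Quotient.mk_surjective _ z
    rw [← Submodule.Quotient.mk_smul, Submodule.Quotient.mk_eq_zero]
    exact Submodule.smul_mem_smul ha trivial
  have hI : Ideal.ofList rs ≤ maximalIdeal A := Ideal.span_le.2 hm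
  -- `A/(rs)` has a copy of the residue field in its socle. Sending `y` to a generator of it defines
  -- `φ₀` on the span of `y`, as the annihilator of `y` lies in `𝔪`.
  obtain ⟨f, hf⟩ := exists_injective_of_forall_not_isSMulRegular
    (not_isSMulRegular_of_length_eq hd hm hreg hlen)
  have hJ : Ideal.torsionOf A N y ≤ maximalIdeal A :=
    le_maximalIdeal fun h => hy (by
      have : (1 : A) ∈ Ideal.torsionOf A N y := h ▸ trivial
      simpa using this)
  let e := Ideal.quotTorsionOfEquivSpanSingleton A N y
  let N' := Submodule.span A {y}
  let φ₀ : N' →ₗ[A] A ⧸ Ideal.ofList rs • (⊤ : Submodule A A) :=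
    f ∘ₗ Submodule.factor hJ ∘ₗ e.symm.toLinearMap
  have hφ₀ : φ₀ ⟨y, Submodule.mem_span_singleton_self y⟩ = f (Submodule.Quotient.mk 1) := by
    have : e (Submodule.Quotient.mk 1) = ⟨y, Submodule.mem_span_singleton_self y⟩ := by
      exact (Ideal.quotTorsionOfEquivSpanSingleton_apply_mk y 1).trans (one_smul _ _)
    rw [← this]
    simp [φ₀]
  -- Self-injectivity of `A/(rs)`: `Ext^(d+1)(N/N', A) = 0` makes restriction on `Ext^d` surjective.
  -- The extended map is then lifted to a functional on `M`.
  obtain ⟨ψ, hψ⟩ := ExtVanishes.exists_extend_mkQ_ofList (X := A) (ι := N'.subtype) hI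
    (hIN.trans (LinearMap.annihilator_le_of_injective N'.subtype N'.injective_subtype)) hIN
    (fun r hr => Ideal.subset_span hr) hreg (fun α => by
      have h1 := hE (N ⧸ N')
      rw [← hlen] at h1
      exact Ext.contravariant_sequence_exact₁ (ExtVanishes.shortExact (f := N'.subtype)
        (g := N'.mkQ) N'.injective_subtype (LinearMap.exact_subtype_mkQ _)
        (Submodule.mkQ_surjective _)) _ α (add_comm 1 _) (h1.elim _ _)) φ₀
  obtain ⟨φ, hφ⟩ := ExtVanishes.exists_lift_mkQ_ofList hreg hM (ψ ∘ₗ Submodule.mkQ _)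
  refine ⟨φ, fun hmem' => ?_⟩
  have h1 := LinearMap.congr_fun hφ m
  have h2 := LinearMap.congr_fun hψ ⟨y, Submodule.mem_span_singleton_self y⟩
  rw [hφ₀] at h2
  have h3 : f (Submodule.Quotient.mk 1) = 0 := by
    rw [← h2]
    refine h1.symm.trans ?_
    rw [LinearMap.comp_apply, Submodule.mkQ_apply, Submodule.Quotient.mk_eq_zero, smul_eq_mul,
      Ideal.mul_top]
    exact hmem'
  have h4 := (injective_iff_map_eq_zero f).1 hf _ h3
  rw [Submodule.Quotient.mk_eq_zero] at h4
  exact (Ideal.ne_top_iff_one _).1 (maximalIdeal.isMaximal A).ne_top h4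

end Duality

/-! ### The map into the free hull -/

section Hull

variable {A : Type u} [CommRing A] {M : Type u} [AddCommGroup M] [Module A M]

instance [Subsingleton M] : IsEmpty (⊤ : Submodule A (Module.Dual A M)).generators := by
  have h : (⊤ : Submodule A (Module.Dual A M)) = ⊥ := Subsingleton.elim _ _
  have h1 := Submodule.generators_card (⊤ : Submodule A (Module.Dual A M))
  rw [h] at h1 ⊢
  exact Cardinal.mk_eq_zero_iff.1 (h1.trans (by simp))

instance finite_generators_dual [IsNoetherianRing A] [Module.Finite A M] :
    Finite (⊤ : Submodule A (Module.Dual A M)).generators := by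
  obtain ⟨n, π, hπ⟩ := Module.Finite.exists_fin' A M
  have : Module.Finite A (Module.Dual A M) :=
    Module.Finite.of_injective (LinearMap.lcomp A A π) fun f g h => by
      ext m
      obtain ⟨x, rfl⟩ := hπ m
      exact LinearMap.congr_fun h x
  exact (Submodule.FG.finite_generators Module.Finite.fg_top).to_subtype

lemma isWeaklyRegular_of_free {F : Type u} [AddCommGroup F] [Module A F] [Module.Free A F]
    {rs : List A} (h : IsWeaklyRegular A rs) : IsWeaklyRegular F rs :=
  ((TensorProduct.rid A F).isWeaklyRegular_congr rs).1 (h.isWeaklyRegular_lTensor (M₂ := F))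

/-- The coordinates of the hull map generate the dual, so a condition on them holds for every
functional. -/
lemma mem_of_hullι_mem {I : Ideal A} {m : M} (h : hullι A M m ∈ I • (⊤ : Submodule A (Hull A M)))
    (φ : M →ₗ[A] A) : φ m ∈ I := by
  have h1 : Submodule.span A (⊤ : Submodule A (Module.Dual A M)).generators ≤
      Submodule.comap (Module.Dual.eval A M m) I := by
    refine Submodule.span_le.2 fun ψ hψ => ?_
    have h2 : ∀ w ∈ I • (⊤ : Submodule A (Hull A M)), w ⟨ψ, hψ⟩ ∈ I := by
      intro w hw
      refine Submodule.smul_induction_on hw (fun a ha v _ => ?_) fun v w hv hw => I.add_mem hv hw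
      exact I.mul_mem_right (v ⟨ψ, hψ⟩) ha
    exact h2 _ h
  rw [Submodule.span_generators] at h1
  exact h1 trivial

end Hull

/-! ### Ext vanishing and co-syzygies of MCM modules -/

section Gorenstein

variable {A : Type u} [CommRing A] [IsLocalRing A]  {M : Type u}
  [AddCommGroup M] [Module A M] (hA : IsGorensteinLocalRing A) {d : ℕ}
  (hd : ringKrullDim A = d) (hM : IsMCM A M)

lemma IsMCM.of_subsingleton [Subsingleton M] (hd : ringKrullDim A = d) : IsMCM A M := by
  refine ⟨inferInstance, List.replicate d 0, fun r hr => ?_, ⟨fun i hi a b _ => Subsingleton.elim a b⟩, ?_⟩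
  · rw [(List.mem_replicate.1 hr).2]
    exact zero_mem _
  · rw [List.length_replicate, hd]

include hA hd hM

lemma IsMCM.extVanishes_self {i : ℕ} (hi : 1 ≤ i) : ExtVanishes A M A i := by
  have := hA.isNoetherianRing
  rcases subsingleton_or_nontrivial M with h | h
  · exact ExtVanishes.of_subsingleton_left
  · exact hM.extVanishes hd (hA.isMCM_and_extVanishes hd hM).2 hi

/-- Functionals separate points modulo an `A`-regular sequence of length `d`, so the hull map is
injective modulo it; injectivity and regularity of the sequence on the cokernel follow. -/
lemma IsMCM.hullι_injective_and_cosyz :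
    Function.Injective (hullι A M) ∧ IsMCM A (Cosyz A M) := by
  have := hA.isNoetherianRing
  have := hM.finite
  rcases subsingleton_or_nontrivial M with h | h
  · exact ⟨Function.injective_of_subsingleton _, IsMCM.of_subsingleton hd⟩
  · obtain ⟨hAA, hE⟩ := hA.isMCM_and_extVanishes hd hM
    obtain ⟨rs, hm, hreg, hlen⟩ := hAA.exists_regular_length hd
    obtain ⟨h1, h2⟩ := injective_and_isWeaklyRegular_of_injective_mod (f := hullι A M) hm
      (isWeaklyRegular_of_free hreg) (fun m h => by
        by_contra hmem
        obtain ⟨φ, hφ⟩ := exists_dual_apply_notMem_ofList hd (hE _ le_rfl) hm hreg hlen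
          (fun i hi => hM.extVanishes_self hA hd hi) hmem
        exact hφ (mem_of_hullι_mem h φ))
    exact ⟨h1, inferInstance, rs, hm, h2, by rw [hlen, hd]⟩

end Gorenstein

/-! ### MCM modules in short exact sequences -/

section Closure

variable {A : Type u} [CommRing A] [IsLocalRing A] [IsNoetherianRing A] {d : ℕ}
  (hd : ringKrullDim A = d) {X Y Z : Type u} [AddCommGroup X] [Module A X] [AddCommGroup Y]
  [Module A Y] [AddCommGroup Z] [Module A Z]

omit [IsNoetherianRing A] in
lemma IsMCM.of_free (h : IsMCM A A) [Module.Free A X] [Module.Finite A X] : IsMCM A X := by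
  obtain ⟨-, rs, hm, hreg, hlen⟩ := h
  exact ⟨inferInstance, rs, hm, isWeaklyRegular_of_free hreg, hlen⟩

variable {f : X →ₗ[A] Y} {g : Y →ₗ[A] Z} (hf : Function.Injective f) (hfg : Function.Exact f g)
  (hg : Function.Surjective g)

include hd hf hfg hg

lemma IsMCM.of_extension (hX : IsMCM A X) (hZ : IsMCM A Z) : IsMCM A Y := by
  have := hX.finite
  have := hZ.finite
  have : Module.Finite A Y := Module.Finite.of_exact hfg hg
  rw [isMCM_iff hd] at hX hZ ⊢
  exact fun i hi => ExtVanishes.middle_right hf hfg hg (hX i hi) (hZ i hi)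

lemma IsMCM.of_kernel (hY : IsMCM A Y) (hZ : IsMCM A Z) : IsMCM A X := by
  have := hY.finite
  have := hZ.finite
  have : Module.Finite A X := Module.Finite.of_injective f hf
  rw [isMCM_iff hd] at hY hZ ⊢
  intro i hi
  cases i with
  | zero => exact ExtVanishes.sub_right_zero hf (hY 0 hi)
  | succ i => exact ExtVanishes.sub_right hf hfg hg (hZ i (by omega)) (hY _ hi)

end Closure

/-! ### Existence, integrality and comparison of the limits -/

section Limit

variable {A : Type u} [CommRing A] [IsLocalRing A] [IsNoetherianRing A]

/-- The quotient by a regular sequence of length `dim A` has dimension zero, so it is Artinian. -/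
lemma exists_maximalIdeal_pow_le_ofList {d : ℕ} (hd : ringKrullDim A = d) {rs : List A}
    (hm : ∀ r ∈ rs, r ∈ maximalIdeal A) (hreg : IsWeaklyRegular A rs) (hlen : rs.length = d) :
    ∃ k, maximalIdeal A ^ k ≤ Ideal.ofList rs := by
  have h1 := ringKrullDim_add_length_eq_ringKrullDim_of_isRegular rs
    (IsRegular.of_isWeaklyRegular_of_mem_maximalIdeal A hm hreg)
  rw [hd, hlen] at h1
  have h2 : ringKrullDim (A ⧸ Ideal.ofList rs) ≤ (0 : ℕ) := by
    by_contra! hlt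
    have h3 : (1 : WithBot ℕ∞) ≤ ringKrullDim (A ⧸ Ideal.ofList rs) := by
      obtain ⟨c, hc⟩ := WithBot.ne_bot_iff_exists.1 (ne_bot_of_gt hlt)
      rw [← hc] at hlt ⊢
      exact WithBot.coe_le_coe.2 (Order.one_le_iff_pos.2 (WithBot.coe_lt_coe.1 hlt))
    have h4 : ((1 + d : ℕ) : WithBot ℕ∞) ≤ d := by
      rw [← h1]
      push_cast
      gcongr
    have : 1 + d ≤ d := by exact_mod_cast h4
    omega
  have : IsArtinianRing (A ⧸ Ideal.ofList rs) :=
    isArtinianRing_iff_isNoetherianRing_krullDimLE_zero.2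
      ⟨inferInstance, Ring.krullDimLE_iff.2 h2⟩
  exact exists_maximalIdeal_pow_le_of_isArtinianRing_quotient _

variable {d : ℕ} (hA : IsGorensteinLocalRing A) (hd : ringKrullDim A = d) (hd1 : 1 ≤ d)
  {M : Type u} [AddCommGroup M] [Module A M]

/-- `e` is the limit of the normalized lengths of `Tor_1(M, A/𝔪^(n+1))`. -/
def IsTorMultiplicity (d : ℕ) (M : Type u) [AddCommGroup M] [Module A M] (e : ℤ) : Prop :=
  Filter.Tendsto (fun n : ℕ => ((d - 1).factorial : ℝ) / (n : ℝ) ^ (d - 1) *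
    ((torLength A (ModuleCat.of A M) n).toNat : ℝ)) Filter.atTop (nhds (e : ℝ))

omit [IsNoetherianRing A] in
lemma IsTorMultiplicity.unique {e e' : ℤ} (h : IsTorMultiplicity (A := A) d M e)
    (h' : IsTorMultiplicity (A := A) d M e') : e = e' := by
  exact_mod_cast tendsto_nhds_unique h h'

omit [IsNoetherianRing A] in
lemma isTorMultiplicity_zero_of_free [Module.Free A M] : IsTorMultiplicity (A := A) d M 0 := by
  simp [IsTorMultiplicity, torLength_eq_zero_of_flat]

omit [IsNoetherianRing A] in
lemma IsTorMultiplicity.nonneg {e : ℤ} (h : IsTorMultiplicity (A := A) d M e) : 0 ≤ e := by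
  have h0 : (0 : ℝ) ≤ (e : ℝ) := ge_of_tendsto' h fun n => by positivity
  exact_mod_cast h0

include hA hd hd1 in
lemma IsMCM.exists_isTorMultiplicity (hM : IsMCM A M) :
    ∃ e : ℤ, IsTorMultiplicity (A := A) d M e ∧ (e = 0 → Module.Free A M) := by
  have := hM.finite
  rcases subsingleton_or_nontrivial M with h | h
  · exact ⟨0, isTorMultiplicity_zero_of_free, fun _ => inferInstance⟩
  · have hAA := (hA.isMCM_and_extVanishes hd hM).1
    obtain ⟨rs, hm, hreg, hlen⟩ := hAA.exists_regular_length hd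
    obtain ⟨k, hk⟩ := exists_maximalIdeal_pow_le_ofList hd hm hreg hlen
    have h1 := eventuallyPoly_torLength M hm hk
    rw [hlen, ← Nat.sub_add_cancel hd1] at h1
    obtain ⟨e, he, he0⟩ := h1.exists_tendsto
    refine ⟨e, by simpa [IsTorMultiplicity] using he, fun h0 =>
      free_of_eventuallyPoly_torLength M (show d - 1 < d by omega) (he0 h0) fun n π hπ => ?_⟩
    -- The syzygy of an MCM module is MCM, so its depth exceeds the degree bound that a zero limit
    -- imposes.
    exact (IsMCM.of_kernel hd π.ker.injective_subtype π.exact_subtype_ker_map hπ hAA.of_free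
      hM).exists_regular_length hd

variable {N L : Type u} [AddCommGroup N] [Module A N] [AddCommGroup L] [Module A L]
  [Module.Finite A N] [Module.Finite A L] {eM eN eL : ℤ}

lemma IsTorMultiplicity.le_add (hM : IsTorMultiplicity (A := A) d M eM)
    (hN : IsTorMultiplicity (A := A) d N eN) (hL : IsTorMultiplicity (A := A) d L eL)
    (h : ∀ n, torLength A (ModuleCat.of A M) n ≤
      torLength A (ModuleCat.of A N) n + torLength A (ModuleCat.of A L) n) : eM ≤ eN + eL := by
  have h1 := le_of_tendsto_of_tendsto' hM (Filter.Tendsto.add hN hL) fun n => by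
    rw [← mul_add, ← Nat.cast_add, ← ENat.toNat_add (torLength_ne_top N n) (torLength_ne_top L n)]
    gcongr
    · simp [torLength_ne_top]
    · exact h n
  exact_mod_cast h1

lemma IsTorMultiplicity.eq_add (hM : IsTorMultiplicity (A := A) d M eM)
    (hN : IsTorMultiplicity (A := A) d N eN) (hL : IsTorMultiplicity (A := A) d L eL)
    (h : ∀ n, torLength A (ModuleCat.of A M) n =
      torLength A (ModuleCat.of A N) n + torLength A (ModuleCat.of A L) n) : eM = eN + eL := by
  have h1 := Filter.Tendsto.add hN hL
  rw [← Int.cast_add] at h1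
  refine hM.unique (h1.congr fun n => ?_)
  rw [← mul_add, ← Nat.cast_add, ← ENat.toNat_add (torLength_ne_top N n) (torLength_ne_top L n),
    h n]

end Limit

/-! ### The exact sequence of the cone -/

section Cone

variable {A : Type u} [CommRing A] {M N : Type u} [AddCommGroup M] [Module A M] [AddCommGroup N]
  [Module A N] (f : M →ₗ[A] N)

lemma coneProj_mk (n : N) (h : Hull A M) :
    coneProj f (Submodule.Quotient.mk (n, h)) = Submodule.Quotient.mk h := rfl

lemma coneInl_apply (n : N) : coneInl f n = Submodule.Quotient.mk (n, 0) := rfl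

lemma coneProj_surjective : Function.Surjective (coneProj f) := by
  intro w
  obtain ⟨h, rfl⟩ := Submodule.Quotient.mk_surjective _ w
  exact ⟨Submodule.Quotient.mk (0, h), rfl⟩

lemma exact_coneInl_coneProj : Function.Exact (coneInl f) (coneProj f) := by
  intro c
  constructor
  · intro hc
    obtain ⟨⟨n, h⟩, rfl⟩ := Submodule.Quotient.mk_surjective _ c
    rw [coneProj_mk, Submodule.Quotient.mk_eq_zero] at hc
    obtain ⟨m, rfl⟩ := hc
    refine ⟨n + f m, ?_⟩
    rw [coneInl_apply, Submodule.Quotient.eq]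
    exact ⟨m, by simp⟩
  · rintro ⟨n, rfl⟩
    rw [coneInl_apply, coneProj_mk, Submodule.Quotient.mk_zero]

lemma coneInl_injective (h : Function.Injective (hullι A M)) : Function.Injective (coneInl f) := by
  refine (injective_iff_map_eq_zero _).2 fun n hn => ?_
  rw [coneInl_apply, Submodule.Quotient.mk_eq_zero] at hn
  obtain ⟨m, hm⟩ := hn
  obtain ⟨h1, h2⟩ := Prod.ext_iff.1 hm
  have h3 : m = 0 := h (by simpa using h2)
  rw [h3] at h1
  simpa using h1.symm

end Cone

/-! ### Comparing two exact sequences -/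

section Comparison

variable {A : Type u} [CommRing A] {X Y Z : Type u} [AddCommGroup X] [Module A X]
  [AddCommGroup Y] [Module A Y] [AddCommGroup Z] [Module A Z] {f : X →ₗ[A] Y} {g : Y →ₗ[A] Z}

lemma exists_factor_of_exact (hfg : Function.Exact f g) (hg : Function.Surjective g) {W : Type u}
    [AddCommGroup W] [Module A W] (φ : Y →ₗ[A] W) (h : φ ∘ₗ f = 0) :
    ∃ θ : Z →ₗ[A] W, θ ∘ₗ g = φ := by
  refine ⟨(LinearMap.range f).liftQ φ (LinearMap.range_le_ker_iff.2 h) ∘ₗ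
    (hfg.linearEquivOfSurjective hg).symm.toLinearMap, ?_⟩
  ext y
  simp

lemma exists_extend_pi (hf : Function.Injective f) (hfg : Function.Exact f g)
    (hg : Function.Surjective g) (h : ExtVanishes A Z A 1) {κ : Type u} (φ : X →ₗ[A] (κ → A)) :
    ∃ ψ : Y →ₗ[A] (κ → A), ψ ∘ₗ f = φ := by
  choose ψ hψ using fun k => ExtVanishes.exists_extend hf hfg hg h (LinearMap.proj k ∘ₗ φ)
  refine ⟨LinearMap.pi ψ, ?_⟩
  ext x k
  exact LinearMap.congr_fun (hψ k) x

variable [IsLocalRing A]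

/-- If `0 → X → Y → Z → 0` and `0 → X → H → Q → 0` are exact and `Y → H` is compatible with
them, then `0 → Y → Z × H → Q → 0` is exact. -/
lemma torLength_prod_le_of_comparison (hfg : Function.Exact f g)
    (hg : Function.Surjective g) {H Q : Type u} [AddCommGroup H] [Module A H] [AddCommGroup Q]
    [Module A Q] {ι : X →ₗ[A] H} {π : H →ₗ[A] Q} (hι : Function.Injective ι)
    (hιπ : Function.Exact ι π) (hπ : Function.Surjective π) {ψ : Y →ₗ[A] H} (hψ : ψ ∘ₗ f = ι)
    (n : ℕ) : torLength A (ModuleCat.of A (Z × H)) n ≤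
      torLength A (ModuleCat.of A Y) n + torLength A (ModuleCat.of A Q) n := by
  have hψ' : ∀ x, ψ (f x) = ι x := LinearMap.congr_fun hψ
  obtain ⟨θ, hθ⟩ := exists_factor_of_exact hfg hg (π ∘ₗ ψ) (by
    rw [LinearMap.comp_assoc, hψ, hιπ.linearMap_comp_eq_zero])
  have hθ' : ∀ y, θ (g y) = π (ψ y) := LinearMap.congr_fun hθ
  refine torLength_le_add (f := g.prod ψ) (g := (-θ).coprod π) ?_ ?_ ?_ n
  · refine (injective_iff_map_eq_zero _).2 fun y hy => ?_
    obtain ⟨h1, h2⟩ := Prod.ext_iff.1 hy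
    obtain ⟨x, rfl⟩ := (hfg y).1 h1
    have h3 : ι x = 0 := by rw [← hψ']; exact h2
    rw [(injective_iff_map_eq_zero _).1 hι x h3, map_zero]
  · rintro ⟨z, h⟩
    obtain ⟨y, rfl⟩ := hg z
    simp only [LinearMap.coprod_apply, LinearMap.neg_apply, hθ', Set.mem_range, Prod.ext_iff]
    constructor
    · intro h0
      have h1 : π (h - ψ y) = 0 := by
        rw [map_sub, sub_eq_neg_add, h0]
      obtain ⟨x, hx⟩ := (hιπ _).1 h1
      refine ⟨y + f x, ?_, ?_⟩
      · change g (y + f x) = g y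
        rw [map_add, hfg.apply_apply_eq_zero, add_zero]
      · change ψ (y + f x) = h
        rw [map_add, hψ', hx, add_sub_cancel]
    · rintro ⟨y', h1, h2⟩
      change g y' = g y at h1
      change ψ y' = h at h2
      rw [← hθ', ← h1, ← h2, hθ', neg_add_cancel]
  · intro q
    obtain ⟨h, rfl⟩ := hπ q
    exact ⟨(0, h), by simp⟩

end Comparison

/-! ### Invariance under stable isomorphism -/

section Stable

variable {A : Type u} [CommRing A] [IsLocalRing A]

lemma factorsThroughFree_of_comp {M N F : Type u} [AddCommGroup M] [Module A M] [AddCommGroup N]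
    [Module A N] [AddCommGroup F] [Module A F] [Module.Free A F] [Module.Finite A F]
    (a : M →ₗ[A] F) (b : F →ₗ[A] N) : FactorsThroughFree (b ∘ₗ a) := by
  let e := (Module.finBasis A F).equivFun
  refine ⟨_, e.toLinearMap ∘ₗ a, b ∘ₗ e.symm.toLinearMap, ?_⟩
  ext m
  simp

lemma exists_factorsThroughFree_of_iso {M N : CM A} (i : (stab A).obj M ≅ (stab A).obj N) :
    ∃ (f : M.obj →ₗ[A] N.obj) (g : N.obj →ₗ[A] M.obj),
      FactorsThroughFree (g ∘ₗ f - LinearMap.id) ∧ FactorsThroughFree (f ∘ₗ g - LinearMap.id) := by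
  obtain ⟨f, hf⟩ := (stab A).map_surjective i.hom
  obtain ⟨g, hg⟩ := (stab A).map_surjective i.inv
  refine ⟨CM.toLinearMap f, CM.toLinearMap g, ?_, ?_⟩
  · refine (CategoryTheory.Quotient.functor_map_eq_iff (stableRel A) (f ≫ g) (𝟙 M)).1 ?_
    exact ((stab A).map_comp f g).trans (by rw [hf, hg, i.hom_inv_id]; rfl)
  · refine (CategoryTheory.Quotient.functor_map_eq_iff (stableRel A) (g ≫ f) (𝟙 N)).1 ?_
    exact ((stab A).map_comp g f).trans (by rw [hf, hg, i.inv_hom_id]; rfl)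

lemma torLength_eq_of_iso {M N : CM A} (i : (stab A).obj M ≅ (stab A).obj N) (n : ℕ) :
    torLength A M.obj n = torLength A N.obj n := by
  obtain ⟨f, g, h1, h2⟩ := exists_factorsThroughFree_of_iso i
  exact le_antisymm (torLength_le_of_factorsThroughFree f g h1 n)
    (torLength_le_of_factorsThroughFree g f h2 n)

lemma isZero_of_free {M : CM A} (h : Module.Free A M.obj) : Limits.IsZero ((stab A).obj M) := by
  have := M.property.finite
  constructor
  · intro Y
    refine ⟨⟨⟨(stab A).map (CM.ofHom 0 : M ⟶ Y.as)⟩, fun φ => ?_⟩⟩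
    obtain ⟨f, rfl⟩ := (stab A).map_surjective (Y := Y.as) φ
    exact (CategoryTheory.Quotient.functor_map_eq_iff (stableRel A) _ _).2
      (by
      rw [stableRel, ← LinearMap.comp_id (CM.toLinearMap f - _)]
      exact factorsThroughFree_of_comp _ _)
  · intro Y
    refine ⟨⟨⟨(stab A).map (CM.ofHom 0 : Y.as ⟶ M)⟩, fun φ => ?_⟩⟩
    obtain ⟨f, rfl⟩ := (stab A).map_surjective (X := Y.as) φ
    exact (CategoryTheory.Quotient.functor_map_eq_iff (stableRel A) _ _).2
      (by
      rw [stableRel, ← LinearMap.id_comp (CM.toLinearMap f - _)]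
      exact factorsThroughFree_of_comp _ _)

/-- On a zero object the identity factors stably through zero, so `Tor₁` embeds in that of the zero
module. -/
lemma torLength_eq_zero_of_isZero {M : CM A} (h : Limits.IsZero ((stab A).obj M)) (n : ℕ) :
    torLength A M.obj n = 0 := by
  have h1 : FactorsThroughFree (CM.toLinearMap (CM.ofHom (M := M) (N := M) 0) -
      CM.toLinearMap (𝟙 M)) :=
    (CategoryTheory.Quotient.functor_map_eq_iff (stableRel A) _ _).1 (h.eq_of_src _ _)
  have h2 := torLength_le_of_factorsThroughFree (A := A) (M := M.obj) (N := PUnit.{u + 1}) 0 0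
    (by rw [LinearMap.zero_comp]; exact h1) n
  rw [torLength_eq_zero_of_flat PUnit.{u + 1}] at h2
  exact nonpos_iff_eq_zero.1 h2

end Stable

/-! ### Stable invariance of the co-syzygy -/

section Translation

variable {A : Type u} [CommRing A] [IsLocalRing A] (hA : IsGorensteinLocalRing A) {d : ℕ}
  (hd : ringKrullDim A = d) {M N : Type u} [AddCommGroup M] [Module A M] [AddCommGroup N]
  [Module A N] (hM : IsMCM A M) (hN : IsMCM A N)

include hA hd hM

/-- Maps from `M` to a power of `A` extend along `M → G^*`. -/
lemma IsMCM.exists_extend_hull {κ : Type u} (φ : M →ₗ[A] (κ → A)) :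
    ∃ ψ : Hull A M →ₗ[A] (κ → A), ψ ∘ₗ hullι A M = φ :=
  exists_extend_pi (hM.hullι_injective_and_cosyz hA hd).1 (hullι A M).exact_map_mkQ_range
    (Submodule.mkQ_surjective _)
    ((hM.hullι_injective_and_cosyz hA hd).2.extVanishes_self hA hd le_rfl) φ

lemma IsMCM.exists_cosyz_map (f : M →ₗ[A] N) :
    ∃ (F : Hull A M →ₗ[A] Hull A N) (c : Cosyz A M →ₗ[A] Cosyz A N),
      F ∘ₗ hullι A M = hullι A N ∘ₗ f ∧ c ∘ₗ hullπ A M = hullπ A N ∘ₗ F := by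
  obtain ⟨F, hF⟩ := hM.exists_extend_hull hA hd (hullι A N ∘ₗ f)
  obtain ⟨c, hc⟩ := exists_factor_of_exact (hullι A M).exact_map_mkQ_range
    (Submodule.mkQ_surjective _) (hullπ A N ∘ₗ F) (by
      rw [LinearMap.comp_assoc, hF, ← LinearMap.comp_assoc, LinearMap.range_mkQ_comp,
        LinearMap.zero_comp])
  exact ⟨F, c, hF, hc⟩

/-- With `φ = b ∘ a`, extend `a` to the hull. Then `Φ` minus the composite of this extension, `b`
and the hull map vanishes on `M`, so it descends to `t : Ω⁻¹(M) → G^*`. Projecting kills the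
correction, so `χ` factors through the free module `G^*`. -/
lemma IsMCM.factorsThroughFree_cosyz {φ : M →ₗ[A] M} {Φ : Hull A M →ₗ[A] Hull A M}
    {χ : Cosyz A M →ₗ[A] Cosyz A M} (h1 : Φ ∘ₗ hullι A M = hullι A M ∘ₗ φ)
    (h2 : χ ∘ₗ hullπ A M = hullπ A M ∘ₗ Φ) (h : FactorsThroughFree φ) : FactorsThroughFree χ := by
  have := hA.isNoetherianRing
  have := hM.finite
  obtain ⟨n, a, b, rfl⟩ := h
  let s : (Fin n → A) ≃ₗ[A] (ULift.{u} (Fin n) → A) := LinearEquiv.funCongrLeft A A Equiv.ulift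
  obtain ⟨a', ha'⟩ := hM.exists_extend_hull hA hd (s.toLinearMap ∘ₗ a)
  obtain ⟨t, ht⟩ := exists_factor_of_exact (hullι A M).exact_map_mkQ_range
    (Submodule.mkQ_surjective _) (Φ - hullι A M ∘ₗ b ∘ₗ s.symm.toLinearMap ∘ₗ a') (by
      ext1 m
      have h3 := LinearMap.congr_fun ha' m
      have h4 := LinearMap.congr_fun h1 m
      simp only [LinearMap.comp_apply, LinearEquiv.coe_coe] at h3 h4
      simp [h3, h4])
  have h5 : χ = hullπ A M ∘ₗ t := by
    refine LinearMap.cancel_right (Submodule.mkQ_surjective (LinearMap.range (hullι A M))) |>.1 ?_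
    rw [LinearMap.comp_assoc, ht, LinearMap.comp_sub, ← LinearMap.comp_assoc _ _ (hullπ A M),
      LinearMap.range_mkQ_comp, LinearMap.zero_comp, sub_zero]
    exact h2
  rw [h5]
  exact factorsThroughFree_of_comp _ _

include hN

lemma torLength_cosyz_le {f : M →ₗ[A] N} {g : N →ₗ[A] M}
    (h : FactorsThroughFree (g ∘ₗ f - LinearMap.id)) (n : ℕ) :
    torLength A (ModuleCat.of A (Cosyz A M)) n ≤ torLength A (ModuleCat.of A (Cosyz A N)) n := by
  obtain ⟨F, c, hF, hc⟩ := hM.exists_cosyz_map hA hd f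
  obtain ⟨G, e, hG, he⟩ := hN.exists_cosyz_map hA hd g
  refine torLength_le_of_factorsThroughFree c e
    (hM.factorsThroughFree_cosyz hA hd (Φ := G ∘ₗ F - LinearMap.id) ?_ ?_ h) n
  · rw [LinearMap.sub_comp, LinearMap.comp_sub, LinearMap.comp_assoc, hF, ← LinearMap.comp_assoc,
      hG, LinearMap.comp_assoc, LinearMap.id_comp, LinearMap.comp_id]
  · rw [LinearMap.sub_comp, LinearMap.comp_sub, LinearMap.comp_assoc, hc, ← LinearMap.comp_assoc,
      he, LinearMap.comp_assoc, LinearMap.id_comp, LinearMap.comp_id]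

end Translation

/-! ### The three inequalities and the theorem -/

section Main

variable {A : Type u} [CommRing A] [IsLocalRing A] (hA : IsGorensteinLocalRing A) {d : ℕ}
  (hd : ringKrullDim A = d)

include hA hd

lemma torLength_cosyzObj_eq_of_iso (h : MCMClosed A) {M N : CM A}
    (i : (stab A).obj M ≅ (stab A).obj N) (n : ℕ) :
    torLength A (h.cosyzObj M).obj n = torLength A (h.cosyzObj N).obj n := by
  obtain ⟨f, g, h1, h2⟩ := exists_factorsThroughFree_of_iso i
  exact le_antisymm (torLength_cosyz_le hA hd M.property N.property h1 n)
    (torLength_cosyz_le hA hd N.property M.property h2 n)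

lemma IsMCM.cone {M N : Type u} [AddCommGroup M] [Module A M] [AddCommGroup N] [Module A N]
    (hM : IsMCM A M) (hN : IsMCM A N) (f : M →ₗ[A] N) : IsMCM A (Cone f) := by
  have := hA.isNoetherianRing
  obtain ⟨h1, h2⟩ := hM.hullι_injective_and_cosyz hA hd
  exact IsMCM.of_extension hd (coneInl_injective f h1) (exact_coneInl_coneProj f)
    (coneProj_surjective f) hN h2

lemma mcmClosed : MCMClosed A where
  prod M N := by
    have := hA.isNoetherianRing
    exact IsMCM.of_extension hd LinearMap.inl_injective Function.Exact.inl_snd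
      LinearMap.snd_surjective M.property N.property
  cosyz M := (M.property.hullι_injective_and_cosyz hA hd).2
  cone {M N} f := M.property.cone hA hd N.property _

variable {M N : Type u} [AddCommGroup M] [Module A M] [AddCommGroup N] [Module A N]
  (hM : IsMCM A M) (f : M →ₗ[A] N) (n : ℕ)

include hM

lemma torLength_le_cone : torLength A (ModuleCat.of A N) n ≤
    torLength A (ModuleCat.of A M) n + torLength A (ModuleCat.of A (Cone f)) n := by
  refine le_trans ?_ (torLength_le_add (f := f.prod (-hullι A M))
    (g := (LinearMap.range (f.prod (-hullι A M))).mkQ) (fun x y hxy => ?_)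
    (LinearMap.exact_map_mkQ_range _) (Submodule.mkQ_surjective _) n)
  · rw [torLength_prod]
    exact le_self_add
  · exact (hM.hullι_injective_and_cosyz hA hd).1 (neg_injective (Prod.ext_iff.1 hxy).2)

lemma torLength_cone_le : torLength A (ModuleCat.of A (Cone f)) n ≤
    torLength A (ModuleCat.of A N) n + torLength A (ModuleCat.of A (Cosyz A M)) n :=
  torLength_le_add (coneInl_injective f (hM.hullι_injective_and_cosyz hA hd).1)
    (exact_coneInl_coneProj f) (coneProj_surjective f) n

/-- `Ext¹(Ω⁻¹(M), A) = 0` extends the hull map of `N` over the cone. Comparing the resulting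
sequences realizes `Ω⁻¹(M)`, up to a free summand, as an extension of `Ω⁻¹(N)` by the cone. -/
lemma torLength_cosyz_le_cone (hN : IsMCM A N) : torLength A (ModuleCat.of A (Cosyz A M)) n ≤
    torLength A (ModuleCat.of A (Cone f)) n + torLength A (ModuleCat.of A (Cosyz A N)) n := by
  obtain ⟨h1, h2⟩ := hM.hullι_injective_and_cosyz hA hd
  obtain ⟨ψ, hψ⟩ := exists_extend_pi (coneInl_injective f h1) (exact_coneInl_coneProj f)
    (coneProj_surjective f) (h2.extVanishes_self hA hd le_rfl) (hullι A N)
  refine le_trans ?_ (torLength_prod_le_of_comparison (exact_coneInl_coneProj f)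
    (coneProj_surjective f) (hN.hullι_injective_and_cosyz hA hd).1
    (hullι A N).exact_map_mkQ_range (Submodule.mkQ_surjective _) hψ n)
  rw [torLength_prod]
  exact le_self_add

end Main

theorem theorem1p2 (A : Type u) [CommRing A] [IsLocalRing A] (hA : IsGorensteinLocalRing A)
    (d : ℕ) (hd : ringKrullDim A = d) (hd1 : 1 ≤ d) :
    (∀ (M : CM A) (n : ℕ), torLength A M.obj n ≠ ⊤) ∧
    ∃ (h : MCMClosed A) (ξ : ICM A → ℤ),
      (∀ M : CM A, Filter.Tendsto
        (fun n : ℕ => ((d - 1).factorial : ℝ) / (n : ℝ) ^ (d - 1) * ((torLength A M.obj n).toNat : ℝ))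
        Filter.atTop (nhds (ξ (ICM.mk ((stab A).obj M)) : ℝ))) ∧
      h.IsTriangleFunction ξ ∧
      (∀ M : CM A, ξ (ICM.mk ((stab A).obj M)) = 0 ↔ Module.Free A M.obj) := by
  have := hA.isNoetherianRing
  have hfin : ∀ M : CM A, Module.Finite A M.obj := fun M => M.property.finite
  refine ⟨fun M n => torLength_ne_top M.obj n, mcmClosed hA hd, ?_⟩
  choose e he he0 using fun M : CM A => M.property.exists_isTorMultiplicity hA hd hd1
  have heq : ∀ {M N : CM A}, (∀ n, torLength A M.obj n = torLength A N.obj n) → e M = e N :=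
    fun {M N} hMN => (he M).unique ((he N).congr fun n => by rw [← hMN n])
  let ξ : ICM A → ℤ := _root_.Quotient.lift (fun X : StableCM A => e X.as)
    fun X Y ⟨i⟩ => heq (torLength_eq_of_iso (M := X.as) (N := Y.as) i)
  have hfree : ∀ M : CM A, e M = 0 ↔ Module.Free A M.obj := fun M =>
    ⟨he0 M, fun _ => (he M).unique isTorMultiplicity_zero_of_free⟩
  refine ⟨ξ, he, ⟨fun M => (he M.as).nonneg, fun M => ?_, fun M N => ?_, ?_⟩, hfree⟩
  · refine ⟨fun h0 => isZero_of_free ((hfree M.as).1 h0), fun h0 => (he M.as).unique ?_⟩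
    simp [IsTorMultiplicity, torLength_eq_zero_of_isZero (M := M.as) h0]
  · exact (he ((mcmClosed hA hd).sumObj M N)).eq_add (he M) (he N) fun n => torLength_prod _ _ n
  · rintro M N L u v w ⟨M', N', f, α, β, γ, δ, -⟩
    have hα : e M.as = e M' := heq (torLength_eq_of_iso (M := M.as) α)
    have hβ : e N.as = e N' := heq (torLength_eq_of_iso (M := N.as) β)
    have hγ : e L.as = e ((mcmClosed hA hd).coneObj f) := heq (torLength_eq_of_iso (M := L.as) γ)
    -- The translates are compared through `α` and `β` themselves, since co-syzygies of stably
    -- isomorphic modules have equal Tor lengths.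
    have hδ : e ((mcmClosed hA hd).cosyzObj M.as) = e ((mcmClosed hA hd).cosyzObj M') :=
      heq (torLength_cosyzObj_eq_of_iso hA hd _ (M := M.as) α)
    have hε : e ((mcmClosed hA hd).cosyzObj N.as) = e ((mcmClosed hA hd).cosyzObj N') :=
      heq (torLength_cosyzObj_eq_of_iso hA hd _ (M := N.as) β)
    change e N.as ≤ e M.as + e L.as ∧
      e L.as ≤ e N.as + e ((mcmClosed hA hd).cosyzObj M.as) ∧
      e ((mcmClosed hA hd).cosyzObj M.as) ≤ e L.as + e ((mcmClosed hA hd).cosyzObj N.as)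
    rw [hα, hβ, hγ, hδ, hε]
    exact ⟨(he N').le_add (he M') (he _) (torLength_le_cone hA hd M'.property _),
      (he _).le_add (he N') (he _) (torLength_cone_le hA hd M'.property _),
      (he _).le_add (he _) (he _) (fun n => torLength_cosyz_le_cone hA hd M'.property _ n N'.property)⟩
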